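/- There are universal constants $c_0\in(0,0.01)$, $C_0>1$, $K>0$ and $p\in\mathbb N$ such that the following holds. Let $d,n$ be natural numbers and let $\eta,\gamma,\rho,\beta$ be reals with $0\le\eta\le\gamma\le c_0$, $\gamma>0$, $0<\beta<1$, $\rho>0$ and $$K\,\eta\,\log(1/\eta)^p\le\rho\le c_0\sqrt d$$ (the left-hand side being $0$ if $\eta=0$). Put $$f=\frac{d+\log(1/\beta)}{\gamma^2}+\frac{(d+\log(1/\beta))^2}{\rho^2},$$ and suppose $n\ge K\,f\,(\log f)^p$, i.e. $n\ge\widetilde O(f)$. Then there is a (deterministic, possibly inefficient) estimator $\mathcal A_0$, that is, a map from $(\mathbb R^d)^n$ to the set of pairs $(\hat\mu,\hat\Sigma)$ with $\hat\mu\in\mathbb R^d$ and $\hat\Sigma\in\mathbb R^{d\times d}$ symmetric positive definite, which may depend on $d,n,\eta,\gamma,\rho,\beta$ only, such that for every $\mu\in\mathbb R^d$ and every positive definite $\Sigma\in\mathbb R^{d\times d}$ the following holds. With probability at least $1-\beta$ over i.i.d. samples $\mathbf X=(X_1,\dots,X_n)$ from $\mathcal N(\mu,\Sigma)$, simultaneously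 for all datasets $\mathbf X'=(X_1',\dots,X_n')\in(\mathbb R^d)^n$ with $\#\{i: X_i\ne X_i'\}\le\eta n$, the output $(\hat\mu,\hat\Sigma)=\mathcal A_0(\mathbf X')$ satisfies $$\|\Sigma^{-1/2}\hat\Sigma\Sigma^{-1/2}-I\|_{op}\le C_0\gamma,\qquad \|\Sigma^{-1/2}\hat\Sigma\Sigma^{-1/2}-I\|_{F}\le C_0\rho,\qquad \|\Sigma^{-1/2}(\hat\mu-\mu)\|_2\le C_0\gamma .$$ -/

import Mathlib

open MeasureTheory ProbabilityTheory

noncomputable section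

/-- A mean-covariance pair `(μ, Σ)`: a vector in `ℝ^d` and a (symmetric) positive definite
`d × d` matrix. -/
structure MeanCov (d : ℕ) where
  mean : EuclideanSpace ℝ (Fin d)
  cov : Matrix (Fin d) (Fin d) ℝ
  posDef : cov.PosDef

open scoped MatrixOrder in
/-- `S^{-1/2}`, the inverse of the positive semidefinite square root of `S`. -/
def invSqrt {d : ℕ} (S : Matrix (Fin d) (Fin d) ℝ) : Matrix (Fin d) (Fin d) ℝ :=
  (CFC.sqrt S)⁻¹

/-- The operator norm `‖M‖_op` with respect to the Euclidean norm. -/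
def opNorm {d : ℕ} (M : Matrix (Fin d) (Fin d) ℝ) : ℝ :=
  ‖Matrix.toEuclideanCLM (𝕜 := ℝ) M‖

/-- The Frobenius norm `‖M‖_F`. -/
def frobNorm {d : ℕ} (M : Matrix (Fin d) (Fin d) ℝ) : ℝ :=
  Real.sqrt (∑ i, ∑ j, M i j ^ 2)

/-- `θ' ≈_{γ, ρ, τ} θ`: closeness in spectral, Frobenius and Mahalanobis distance, all three
normalized by the covariance of `θ`. -/
structure Approx {d : ℕ} (γ ρ τ : ℝ) (θ' θ : MeanCov d) : Prop where
  spectral : opNorm (invSqrt θ.cov * θ'.cov * invSqrt θ.cov - 1) ≤ γ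
  frobenius : frobNorm (invSqrt θ.cov * θ'.cov * invSqrt θ.cov - 1) ≤ ρ
  mahalanobis : ‖Matrix.toEuclideanCLM (𝕜 := ℝ) (invSqrt θ.cov) (θ'.mean - θ.mean)‖ ≤ τ

/-- A dataset of `n` points in `ℝ^d`. -/
abbrev Dataset (d n : ℕ) : Type := Fin n → EuclideanSpace ℝ (Fin d)

open scoped Classical in
/-- `X'` is an `η`-corruption of `X`: at most `η * n` of the `n` points were changed. -/
def IsCorruption {d n : ℕ} (η : ℝ) (X X' : Dataset d n) : Prop :=
  (hammingDist X X' : ℝ) ≤ η * n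

/-- The law of `n` i.i.d. samples from `N(μ, Σ)`. -/
def gaussianSamples {d : ℕ} (n : ℕ) (θ : MeanCov d) : Measure (Dataset d n) :=
  Measure.pi fun _ : Fin n => multivariateGaussian θ.mean θ.cov

/-- The leading term `(d + log(1/β))/γ² + (d + log(1/β))²/ρ²` of the sample complexity. -/
def sampleTerm (d : ℕ) (β γ ρ : ℝ) : ℝ :=
  (d + Real.log (1 / β)) / γ ^ 2 + (d + Real.log (1 / β)) ^ 2 / ρ ^ 2

end

/-! The estimator returns any model `θ'` for which the observed data are an `η`-corruption of some
dataset `Y` whose standardization by `θ'` passes a list of tests (`LooksGaussian`). Standard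
Gaussian samples pass the tests with probability at least `1 - β`, so with that probability the true
model is itself a candidate for every corruption at once. The remaining claim is deterministic
(`approx_of_looksGaussian`): if `X` looks Gaussian after standardization by `θ`, `Y` does so by
`θ'`, and `X`, `Y` differ in at most `2ηn` places, then `θ` and `θ'` are close.

After rotations from the singular value decomposition of `Σ^{-1/2} Σ'^{1/2}`, the shared points
satisfy `z = m + s·w` coordinatewise, and the three distances become bounds on `s j ^ 2 - 1` and
`m`. Replacing `2ηn` terms in an average of bounded quantities costs only `O(η)`. Bounds for each `s
j` and for `m` come from comparing empirical characteristic functions on the unit ball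
(`abs_sq_sub_one_le`, `norm_mean_le`).

For the Frobenius norm `r` of `s² - 1`, take the unit vector `a = (s² - 1)/r` and `q(z) = ∑ a j (z
j² - 1)`. Passing from `w` to `m + s·w` raises `q` by about `r` on average, whereas `q` has bounded
variance under the standard Gaussian. For `ρ ≤ 200` the shift is detected by the mean of the
truncated `q` (`sum_sq_le_of_clipTest`). For `ρ > 200` a bounded statistic only gives tails `exp
(-cn)`, too weak for a net of log-size about `d²` when `n` is about `d²/ρ²`. The test then counts
the points with `|q| > ρ`: spectral closeness gives `|a j| ≤ 1/ρ`, so each point is bad with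
probability `exp (-cρ²)`, and a quarter of the points are bad with probability about `exp (-cnρ²)`
(`sum_sq_le_of_countTest`).

That Gaussian samples pass is Hoeffding or Chernoff for one test function and a union bound over a
net of coefficients, of dimension `d + 1` for the characteristic function and `d² + d + 1` for
quadratic polynomials. These give the two terms `D/γ²` and `D²/ρ²` of the sample size, with `D = d +
log (1/β)`. -/

/-! ### Nets and uniform concentration under product measures -/

/-- A set of vectors with coordinates bounded by `R` has a finite `δ`-net in sup distance, with
points in the set, of cardinality at most `(4 R / δ) ^ N`. -/
lemma exists_finset_net {ι : Type*} [Fintype ι] [DecidableEq ι] (S : Set (ι → ℝ)) {R δ : ℝ}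
    (hδ : 0 < δ) (hδR : δ ≤ R) (hS : ∀ a ∈ S, ∀ j, |a j| ≤ R) :
    ∃ T : Finset (ι → ℝ), (∀ t ∈ T, t ∈ S) ∧ (T.card : ℝ) ≤ (4 * R / δ) ^ Fintype.card ι ∧
      ∀ a ∈ S, ∃ t ∈ T, ∀ j, |a j - t j| ≤ δ := by
  classical
  let key : (ι → ℝ) → (ι → ℤ) := fun a j => ⌊a j / δ⌋
  let B : Finset (ι → ℤ) := Fintype.piFinset fun _ => Finset.Icc ⌊-R / δ⌋ ⌊R / δ⌋
  have hkey : ∀ a ∈ S, key a ∈ B := by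
    intro a ha
    simp only [B, key, Fintype.mem_piFinset, Finset.mem_Icc]
    intro j
    have := abs_le.1 (hS a ha j)
    exact ⟨Int.floor_le_floor (by gcongr; exact this.1),
      Int.floor_le_floor (by gcongr; exact this.2)⟩
  -- Representatives are chosen inside `S`, one per nonempty cell, since later tail bounds are
  -- available only for members of `S`.
  let B' := B.filter fun k => ∃ a ∈ S, key a = k
  have hB' : ∀ k ∈ B', ∃ a ∈ S, key a = k := fun k hk => (Finset.mem_filter.1 hk).2
  choose! g hg using hB'
  refine ⟨B'.image g, ?_, ?_, ?_⟩
  · intro t ht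
    obtain ⟨k, hk, rfl⟩ := Finset.mem_image.1 ht
    exact (hg k hk).1
  · have h1 : ((B'.image g).card : ℝ) ≤ B.card := by
      exact_mod_cast Finset.card_image_le.trans (Finset.card_filter_le _ _)
    refine h1.trans ?_
    simp only [B, Fintype.card_piFinset, Finset.prod_const, Finset.card_univ, Int.card_Icc]
    push_cast
    -- Each coordinate meets at most `2R/δ + 2` cells, which is at most `4R/δ` because `R/δ ≥ 1`.
    have hq : 1 ≤ R / δ := (one_le_div hδ).2 hδR
    refine pow_le_pow_left₀ (by positivity) ?_ _
    have h2 : ⌊-R / δ⌋ ≤ ⌊R / δ⌋ := Int.floor_le_floor (by rw [neg_div]; linarith)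
    have h3 : (((⌊R / δ⌋ + 1 - ⌊-R / δ⌋).toNat : ℕ) : ℝ)
        = (⌊R / δ⌋ : ℝ) + 1 - (⌊-R / δ⌋ : ℝ) := by
      have : (((⌊R / δ⌋ + 1 - ⌊-R / δ⌋).toNat : ℤ) : ℝ) = ((⌊R / δ⌋ + 1 - ⌊-R / δ⌋ : ℤ) : ℝ) := by
        rw [Int.toNat_of_nonneg (by linarith)]
      exact_mod_cast this
    have h4 := Int.floor_le (R / δ)
    have h5 := Int.sub_one_lt_floor (-R / δ)
    rw [h3, mul_div_assoc]
    have h6 : -R / δ = -(R / δ) := neg_div _ _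
    linarith
  · intro a ha
    have hk : key a ∈ B' := Finset.mem_filter.2 ⟨hkey a ha, a, ha, rfl⟩
    refine ⟨g (key a), Finset.mem_image_of_mem g hk, fun j => ?_⟩
    have h1 : ⌊g (key a) j / δ⌋ = ⌊a j / δ⌋ := congrFun (hg _ hk).2 j
    have h2 := (Int.abs_sub_lt_one_of_floor_eq_floor h1.symm).le
    rw [← sub_div, abs_div, abs_of_pos hδ, div_le_one hδ] at h2
    exact h2

/-- Chernoff bound for a sum of functions of the coordinates under a product measure. -/
lemma pi_measureReal_le_sum {ι : Type*} [Fintype ι] {E : Type*} [MeasurableSpace E]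
    (μ : Measure E) [IsProbabilityMeasure μ] (h : ι → E → ℝ)
    (hi : ∀ i, Integrable (fun x => Real.exp (h i x)) μ) (t : ℝ) :
    (Measure.pi fun _ : ι => μ).real {Z | t ≤ ∑ i, h i (Z i)}
      ≤ Real.exp (-t) * ∏ i, ∫ x, Real.exp (h i x) ∂μ := by
  have h1 : Integrable (fun Z : ι → E => ∏ i, Real.exp (h i (Z i))) (Measure.pi fun _ : ι => μ) :=
    Integrable.fintype_prod hi
  have h2 := mul_meas_ge_le_integral_of_nonneg (μ := Measure.pi fun _ : ι => μ)
    (f := fun Z : ι → E => ∏ i, Real.exp (h i (Z i)))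
    (Filter.Eventually.of_forall fun Z => Finset.prod_nonneg fun i _ => (Real.exp_pos _).le) h1
    (Real.exp t)
  rw [integral_fintype_prod_eq_prod (μ := fun _ : ι => μ) (fun i x => Real.exp (h i x))] at h2
  simp only [← Real.exp_sum, Real.exp_le_exp] at h2
  rw [Real.exp_neg, inv_mul_eq_div, le_div_iff₀ (Real.exp_pos t), mul_comm]
  exact h2

/-- Hoeffding's inequality for the empirical mean of a bounded function. -/
lemma pi_measureReal_mean_deviation_le {E : Type*} [MeasurableSpace E]
    (μ : Measure E) [IsProbabilityMeasure μ] {n : ℕ} (hn : 0 < n) {h : E → ℝ} (hm : Measurable h)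
    {B ε : ℝ} (hB : 0 < B) (hε : 0 ≤ ε) (hb : ∀ x, |h x| ≤ B) :
    (Measure.pi fun _ : Fin n => μ).real {Z | ε < |(∑ i, h (Z i)) / n - ∫ x, h x ∂μ|}
      ≤ 2 * Real.exp (-(n * ε ^ 2 / (2 * B ^ 2))) := by
  set P := Measure.pi fun _ : Fin n => μ
  have hn' : (0 : ℝ) < n := by exact_mod_cast hn
  have one_side : ∀ g : E → ℝ, Measurable g → (∀ x, |g x| ≤ B) →
      P.real {Z | n * ε ≤ ∑ i, (g (Z i) - ∫ x, g x ∂μ)}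
        ≤ Real.exp (-(n * ε ^ 2 / (2 * B ^ 2))) := by
    intro g hg hgb
    have h0 : HasSubgaussianMGF (fun x => g x - ∫ x, g x ∂μ) ((‖B - (-B)‖₊ / 2) ^ 2) μ :=
      hasSubgaussianMGF_of_mem_Icc hg.aemeasurable
        (Filter.Eventually.of_forall fun x => ⟨(abs_le.1 (hgb x)).1, (abs_le.1 (hgb x)).2⟩)
    have hind : iIndepFun (fun (i : Fin n) (Z : Fin n → E) => g (Z i) - ∫ x, g x ∂μ) P :=
      iIndepFun_pi (μ := fun _ : Fin n => μ) (X := fun _ x => g x - ∫ x, g x ∂μ)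
        fun i => (hg.sub_const _).aemeasurable
    have hsub : ∀ i ∈ (Finset.univ : Finset (Fin n)),
        HasSubgaussianMGF (fun Z : Fin n → E => g (Z i) - ∫ x, g x ∂μ)
          ((‖B - (-B)‖₊ / 2) ^ 2) P := by
      intro i _
      have hmap : P.map (fun Z => Z i) = μ := by
        have := (measurePreserving_eval (fun _ : Fin n => μ) i).map_eq
        exact this
      refine HasSubgaussianMGF.of_map (X := fun x => g x - ∫ x, g x ∂μ)
        (Y := fun Z : Fin n → E => Z i) (measurable_pi_apply i).aemeasurable ?_
      rw [hmap]; exact h0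
    have := HasSubgaussianMGF.measure_sum_ge_le_of_iIndepFun hind (s := Finset.univ) hsub
      (ε := n * ε) (by positivity)
    refine this.trans (le_of_eq ?_)
    congr 1
    have hBB : ‖B - (-B)‖ = 2 * B := by
      rw [Real.norm_eq_abs, abs_of_pos (by linarith)]; ring
    simp only [Finset.sum_const, Finset.card_univ, Fintype.card_fin, nsmul_eq_mul]
    push_cast
    rw [hBB]
    field_simp
  have hsplit : {Z : Fin n → E | ε < |(∑ i, h (Z i)) / n - ∫ x, h x ∂μ|} ⊆
      {Z | n * ε ≤ ∑ i, (h (Z i) - ∫ x, h x ∂μ)} ∪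
      {Z | n * ε ≤ ∑ i, ((fun x => -h x) (Z i) - ∫ x, (fun x => -h x) x ∂μ)} := by
    intro Z hZ
    have hs : ∑ i, (h (Z i) - ∫ x, h x ∂μ) = n * ((∑ i, h (Z i)) / n - ∫ x, h x ∂μ) := by
      rw [Finset.sum_sub_distrib]; simp; field_simp
    have hs' : ∑ i, ((fun x => -h x) (Z i) - ∫ x, (fun x => -h x) x ∂μ)
        = -(n * ((∑ i, h (Z i)) / n - ∫ x, h x ∂μ)) := by
      rw [← hs, integral_neg, ← Finset.sum_neg_distrib]
      refine Finset.sum_congr rfl fun i _ => by ring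
    simp only [Set.mem_ofPred_eq, Set.mem_union] at hZ ⊢
    rw [hs, hs']
    rcases lt_abs.1 hZ with h1 | h1
    · left; exact mul_le_mul_of_nonneg_left h1.le hn'.le
    · right; rw [← mul_neg]; exact mul_le_mul_of_nonneg_left h1.le hn'.le
  calc _ ≤ _ := measureReal_mono hsplit
    _ ≤ _ := measureReal_union_le _ _
    _ ≤ _ := by
      have h1 := one_side h hm hb
      have h2 := one_side (fun x => -h x) hm.neg (fun x => by simpa using hb x)
      linarith

/-- An event of probability at most `exp (-s)` happens for more than `n / 8` of `n` independent
samples with probability at most `exp (n (1 - s / 8))`. -/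
lemma pi_measureReal_count_le {E : Type*} [MeasurableSpace E]
    (μ : Measure E) [IsProbabilityMeasure μ] {n : ℕ} {A : Set E} [DecidablePred (· ∈ A)]
    (hA : MeasurableSet A) {s : ℝ} (hs : μ.real A ≤ Real.exp (-s)) :
    (Measure.pi fun _ : Fin n => μ).real
        {Z | (n : ℝ) / 8 < ((Finset.univ.filter fun i => Z i ∈ A).card : ℝ)}
      ≤ Real.exp (n * (1 - s / 8)) := by
  by_cases hs0 : s < 0
  · refine measureReal_le_one.trans (Real.one_le_exp ?_)
    have : (0 : ℝ) ≤ n := n.cast_nonneg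
    have : 0 ≤ 1 - s / 8 := by linarith
    positivity
  push Not at hs0
  have hexp : (fun x => Real.exp (A.indicator (fun _ => s) x))
      = fun x => 1 + A.indicator (fun _ => Real.exp s - 1) x := by
    ext x
    by_cases hx : x ∈ A <;> simp [hx]
  have hInt : Integrable (fun x => Real.exp (A.indicator (fun _ => s) x)) μ := by
    rw [hexp]
    exact (integrable_const _).add ((integrable_const _).indicator hA)
  -- `E exp (s·1_A) = 1 + P(A)(exp s - 1) ≤ 2 ≤ e`.
  have hval : ∫ x, Real.exp (A.indicator (fun _ => s) x) ∂μ ≤ Real.exp 1 := by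
    rw [hexp, integral_add (integrable_const _) ((integrable_const _).indicator hA),
      integral_indicator_const _ hA]
    simp only [integral_const, probReal_univ, smul_eq_mul, one_mul]
    have h1 : μ.real A * (Real.exp s - 1) ≤ Real.exp (-s) * Real.exp s := by
      refine mul_le_mul hs (by linarith) ?_ (Real.exp_pos _).le
      linarith [Real.add_one_le_exp s]
    rw [← Real.exp_add] at h1
    simp only [neg_add_cancel, Real.exp_zero] at h1
    linarith [Real.add_one_le_exp (1 : ℝ)]
  have hmain := pi_measureReal_le_sum (ι := Fin n) μ (fun _ => A.indicator fun _ => s)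
    (fun _ => hInt) (s * n / 8)
  have hsub : {Z : Fin n → E | (n : ℝ) / 8 < ((Finset.univ.filter fun i => Z i ∈ A).card : ℝ)} ⊆
      {Z | s * n / 8 ≤ ∑ i, A.indicator (fun _ => s) (Z i)} := by
    intro Z hZ
    simp only [Set.mem_ofPred_eq] at hZ ⊢
    have : ∑ i, A.indicator (fun _ => s) (Z i)
        = ((Finset.univ.filter fun i => Z i ∈ A).card : ℝ) * s := by
      simp [Set.indicator_apply, Finset.sum_ite]
    rw [this]
    nlinarith
  calc _ ≤ _ := measureReal_mono hsub
    _ ≤ _ := hmain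
    _ ≤ Real.exp (-(s * n / 8)) * Real.exp 1 ^ n := by
      gcongr
      rw [Finset.prod_const, Finset.card_univ, Fintype.card_fin]
      exact pow_le_pow_left₀ (integral_nonneg fun x => (Real.exp_pos _).le) hval n
    _ = _ := by
      rw [← Real.exp_nat_mul, ← Real.exp_add]; congr 1; ring

/-- Functions in a finite-dimensional linear span change little when the coefficients do. -/
lemma abs_sum_mul_sub_sum_mul_le {ι : Type*} [Fintype ι] {a t : ι → ℝ} {δ : ℝ}
    (h : ∀ j, |a j - t j| ≤ δ) (v : ι → ℝ) :
    |∑ j, a j * v j - ∑ j, t j * v j| ≤ δ * ∑ j, |v j| := by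
  rw [← Finset.sum_sub_distrib, Finset.mul_sum]
  refine (Finset.abs_sum_le_sum_abs _ _).trans (Finset.sum_le_sum fun j _ => ?_)
  rw [← sub_mul, abs_mul]
  exact mul_le_mul_of_nonneg_right (h j) (abs_nonneg _)

/-- Uniform deviation of the empirical means of `φ ∘ q`, where `q` ranges over the linear
combinations of the features `Ψ j` with coefficients bounded by `R`. -/
lemma pi_measureReal_uniform_mean_deviation_le {E : Type*} [MeasurableSpace E]
    (μ : Measure E) [IsProbabilityMeasure μ] {n : ℕ} (hn : 0 < n)
    {ι : Type*} [Fintype ι] [DecidableEq ι] {Ψ : ι → E → ℝ} (hΨ : ∀ j, Measurable (Ψ j))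
    {φ : ℝ → ℝ} (hφ : ∀ x y, |φ x - φ y| ≤ |x - y|) {B : ℝ} (hB : 0 < B) (hφB : ∀ x, |φ x| ≤ B)
    {R δ M ε : ℝ} (hδ : 0 < δ) (hδR : δ ≤ R) (hε : 0 ≤ ε)
    (hInt : Integrable (fun x => ∑ j, |Ψ j x|) μ) (hM : ∫ x, ∑ j, |Ψ j x| ∂μ ≤ M) :
    (Measure.pi fun _ : Fin n => μ).real {Z | ∃ a : ι → ℝ, (∀ j, |a j| ≤ R) ∧
        ε + 2 * δ * M < |(∑ i, φ (∑ j, a j * Ψ j (Z i))) / n - ∫ x, φ (∑ j, a j * Ψ j x) ∂μ|}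
      ≤ (Measure.pi fun _ : Fin n => μ).real {Z | M < (∑ i, ∑ j, |Ψ j (Z i)|) / n}
        + (4 * R / δ) ^ Fintype.card ι * (2 * Real.exp (-(n * ε ^ 2 / (2 * B ^ 2)))) := by
  set P := Measure.pi fun _ : Fin n => μ
  have hn' : (0 : ℝ) < n := by exact_mod_cast hn
  have hφc : Continuous φ := by
    refine (LipschitzWith.of_dist_le_mul (K := 1) fun x y => ?_).continuous
    simpa [Real.dist_eq] using hφ x y
  have hmeas : ∀ a : ι → ℝ, Measurable fun x => φ (∑ j, a j * Ψ j x) := fun a =>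
    hφc.measurable.comp (Finset.measurable_sum _ fun j _ => (hΨ j).const_mul (a j))
  have hIntφ : ∀ a : ι → ℝ, Integrable (fun x => φ (∑ j, a j * Ψ j x)) μ := fun a =>
    Integrable.of_bound (hmeas a).aestronglyMeasurable B
      (Filter.Eventually.of_forall fun x => by rw [Real.norm_eq_abs]; exact hφB _)
  obtain ⟨T, -, hTc, hT⟩ := exists_finset_net {a : ι → ℝ | ∀ j, |a j| ≤ R} hδ hδR fun a ha => ha
  have hsub : {Z : Fin n → E | ∃ a : ι → ℝ, (∀ j, |a j| ≤ R) ∧ ε + 2 * δ * M <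
      |(∑ i, φ (∑ j, a j * Ψ j (Z i))) / n - ∫ x, φ (∑ j, a j * Ψ j x) ∂μ|} ⊆
      {Z | M < (∑ i, ∑ j, |Ψ j (Z i)|) / n} ∪ ⋃ t ∈ T,
        {Z | ε < |(∑ i, φ (∑ j, t j * Ψ j (Z i))) / n - ∫ x, φ (∑ j, t j * Ψ j x) ∂μ|} := by
    rintro Z ⟨a, ha, hlt⟩
    by_cases hZ : M < (∑ i, ∑ j, |Ψ j (Z i)|) / n
    · exact Or.inl hZ
    push Not at hZ
    obtain ⟨t, ht, hat⟩ := hT a ha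
    refine Or.inr (Set.mem_biUnion ht ?_)
    -- The move to the net costs `δM` in the empirical mean and `δM` in the expectation, whence the
    -- `2δM` in the statement.
    have h1 : |(∑ i, φ (∑ j, a j * Ψ j (Z i))) / n - (∑ i, φ (∑ j, t j * Ψ j (Z i))) / n|
        ≤ δ * M := by
      rw [← sub_div, ← Finset.sum_sub_distrib, abs_div, abs_of_pos hn', div_le_iff₀ hn']
      calc _ ≤ ∑ i, |φ (∑ j, a j * Ψ j (Z i)) - φ (∑ j, t j * Ψ j (Z i))| :=
            Finset.abs_sum_le_sum_abs _ _
        _ ≤ ∑ i, δ * ∑ j, |Ψ j (Z i)| := Finset.sum_le_sum fun i _ =>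
            (hφ _ _).trans (abs_sum_mul_sub_sum_mul_le hat fun j => Ψ j (Z i))
        _ = δ * ∑ i, ∑ j, |Ψ j (Z i)| := by rw [Finset.mul_sum]
        _ ≤ δ * (M * n) := by
            gcongr
            exact (div_le_iff₀ hn').1 hZ
        _ = _ := by ring
    have h2 : |(∫ x, φ (∑ j, a j * Ψ j x) ∂μ) - ∫ x, φ (∑ j, t j * Ψ j x) ∂μ| ≤ δ * M := by
      rw [← integral_sub (hIntφ a) (hIntφ t)]
      calc _ ≤ ∫ x, |φ (∑ j, a j * Ψ j x) - φ (∑ j, t j * Ψ j x)| ∂μ :=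
            abs_integral_le_integral_abs
        _ ≤ ∫ x, δ * ∑ j, |Ψ j x| ∂μ := integral_mono ((hIntφ a).sub (hIntφ t)).abs
            (hInt.const_mul δ)
            fun x => (hφ _ _).trans (abs_sum_mul_sub_sum_mul_le hat fun j => Ψ j x)
        _ = δ * ∫ x, ∑ j, |Ψ j x| ∂μ := integral_const_mul _ _
        _ ≤ _ := by gcongr
    simp only [Set.mem_ofPred_eq]
    rw [abs_le] at h1 h2
    rcases lt_abs.1 hlt with h3 | h3
    · exact lt_abs.2 (Or.inl (by linarith))
    · exact lt_abs.2 (Or.inr (by linarith))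
  calc _ ≤ _ := measureReal_mono hsub
    _ ≤ _ := measureReal_union_le _ _
    _ ≤ _ := by
      gcongr
      refine (measureReal_biUnion_finset_le _ _).trans ?_
      refine (Finset.sum_le_sum fun t _ =>
        pi_measureReal_mean_deviation_le μ hn (hmeas t) hB hε fun x => hφB _).trans ?_
      rw [Finset.sum_const, nsmul_eq_mul]
      gcongr

/-- Uniform bound for the number of samples at which a function `q` from a class of linear
combinations of the features `Ψ j` is large. -/
lemma pi_measureReal_uniform_count_le {E : Type*} [MeasurableSpace E]
    (μ : Measure E) [IsProbabilityMeasure μ] {n : ℕ} (hn : 0 < n)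
    {ι : Type*} [Fintype ι] [DecidableEq ι] {Ψ : ι → E → ℝ} (hΨ : ∀ j, Measurable (Ψ j))
    {S : Set (ι → ℝ)} {R δ M τ s : ℝ} (hS : ∀ a ∈ S, ∀ j, |a j| ≤ R)
    (hδ : 0 < δ) (hδR : δ ≤ R) (hτ : 0 < τ) (hδM : δ * M ≤ τ / 8)
    (htail : ∀ a ∈ S, μ.real {x | τ < |∑ j, a j * Ψ j x|} ≤ Real.exp (-s)) :
    (Measure.pi fun _ : Fin n => μ).real {Z | ∃ a ∈ S, (n : ℝ) / 4 <
        ((Finset.univ.filter fun i => 2 * τ < |∑ j, a j * Ψ j (Z i)|).card : ℝ)}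
      ≤ (Measure.pi fun _ : Fin n => μ).real {Z | M < (∑ i, ∑ j, |Ψ j (Z i)|) / n}
        + (4 * R / δ) ^ Fintype.card ι * Real.exp (n * (1 - s / 8)) := by
  set P := Measure.pi fun _ : Fin n => μ
  have hn' : (0 : ℝ) < n := by exact_mod_cast hn
  have hmeas : ∀ a : ι → ℝ, Measurable fun x => ∑ j, a j * Ψ j x := fun a =>
    Finset.measurable_sum _ fun j _ => (hΨ j).const_mul (a j)
  obtain ⟨T, hTS, hTc, hT⟩ := exists_finset_net S hδ hδR hS
  have hsub : {Z : Fin n → E | ∃ a ∈ S, (n : ℝ) / 4 <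
        ((Finset.univ.filter fun i => 2 * τ < |∑ j, a j * Ψ j (Z i)|).card : ℝ)} ⊆
      {Z | M < (∑ i, ∑ j, |Ψ j (Z i)|) / n} ∪ ⋃ t ∈ T,
        {Z | (n : ℝ) / 8 < ((Finset.univ.filter fun i =>
          Z i ∈ {x | τ < |∑ j, t j * Ψ j x|}).card : ℝ)} := by
    rintro Z ⟨a, ha, hlt⟩
    by_cases hZ : M < (∑ i, ∑ j, |Ψ j (Z i)|) / n
    · exact Or.inl hZ
    push Not at hZ
    obtain ⟨t, ht, hat⟩ := hT a ha
    refine Or.inr (Set.mem_biUnion ht ?_)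
    simp only [Set.mem_ofPred_eq]
    -- A value above `2τ` requires either a value above `τ` at the net point or a feature vector of
    -- `ℓ¹` norm at least `τ/δ`. Markov's inequality bounds the second kind by `n/8`.
    have hcov : (Finset.univ.filter fun i => 2 * τ < |∑ j, a j * Ψ j (Z i)|) ⊆
        (Finset.univ.filter fun i => τ < |∑ j, t j * Ψ j (Z i)|) ∪
        (Finset.univ.filter fun i => τ ≤ δ * ∑ j, |Ψ j (Z i)|) := by
      intro i hi
      simp only [Finset.mem_union, Finset.mem_filter, Finset.mem_univ, true_and] at hi ⊢
      by_contra hcon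
      push Not at hcon
      have h1 := abs_sum_mul_sub_sum_mul_le hat fun j => Ψ j (Z i)
      have h2 := abs_sub_abs_le_abs_sub (∑ j, a j * Ψ j (Z i)) (∑ j, t j * Ψ j (Z i))
      linarith [hcon.1, hcon.2]
    have hmarkov : ((Finset.univ.filter fun i => τ ≤ δ * ∑ j, |Ψ j (Z i)|).card : ℝ) ≤ n / 8 := by
      have h1 : ((Finset.univ.filter fun i => τ ≤ δ * ∑ j, |Ψ j (Z i)|).card : ℝ) * τ
          ≤ ∑ i, δ * ∑ j, |Ψ j (Z i)| := by
        rw [← nsmul_eq_mul]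
        refine (Finset.card_nsmul_le_sum _ (fun i => δ * ∑ j, |Ψ j (Z i)|) τ
          fun i hi => (Finset.mem_filter.1 hi).2).trans ?_
        exact Finset.sum_le_sum_of_subset_of_nonneg (Finset.filter_subset _ _)
          fun i _ _ => mul_nonneg hδ.le (Finset.sum_nonneg fun j _ => abs_nonneg _)
      rw [← Finset.mul_sum] at h1
      have h2 := (div_le_iff₀ hn').1 hZ
      have h3 : δ * ∑ i, ∑ j, |Ψ j (Z i)| ≤ δ * M * n := by
        rw [mul_assoc]; gcongr
      have h4 : δ * M * n ≤ τ / 8 * n := by gcongr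
      refine le_of_mul_le_mul_right (a := τ) ?_ hτ
      linarith
    have hcard : ((Finset.univ.filter fun i => 2 * τ < |∑ j, a j * Ψ j (Z i)|).card : ℝ) ≤
        ((Finset.univ.filter fun i => τ < |∑ j, t j * Ψ j (Z i)|).card : ℝ) +
        ((Finset.univ.filter fun i => τ ≤ δ * ∑ j, |Ψ j (Z i)|).card : ℝ) := by
      exact_mod_cast (Finset.card_le_card hcov).trans (Finset.card_union_le _ _)
    linarith
  calc _ ≤ _ := measureReal_mono hsub
    _ ≤ _ := measureReal_union_le _ _
    _ ≤ _ := by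
      gcongr
      refine (measureReal_biUnion_finset_le _ _).trans ?_
      refine (Finset.sum_le_sum fun t ht =>
        pi_measureReal_count_le μ ?_ (htail t (hTS t ht))).trans ?_
      · exact measurableSet_lt measurable_const (hmeas t).abs
      rw [Finset.sum_const, nsmul_eq_mul]
      gcongr

/-! ### Gaussian exponential moments and tails -/

/-- The exponential moments of a centred square of a standard Gaussian variable. -/
lemma gaussianReal_exp_mul_sq_sub_one {x : ℝ} (hx : |x| ≤ 1 / 4) :
    Integrable (fun g : ℝ => Real.exp (x * (g ^ 2 - 1))) (gaussianReal 0 1) ∧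
      ∫ g, Real.exp (x * (g ^ 2 - 1)) ∂(gaussianReal 0 1) ≤ Real.exp (4 * x ^ 2) := by
  have hx' := abs_le.1 hx
  have hb : 0 < 1 / 2 - x := by linarith
  have hval : ∀ g : ℝ, gaussianPDFReal 0 1 g • Real.exp (x * (g ^ 2 - 1))
      = (√(2 * Real.pi))⁻¹ * Real.exp (-x) * Real.exp (-(1 / 2 - x) * g ^ 2) := by
    intro g
    simp only [gaussianPDFReal, smul_eq_mul, NNReal.coe_one, mul_one, sub_zero]
    rw [mul_assoc, mul_assoc, ← Real.exp_add, ← Real.exp_add]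
    congr 2; ring
  constructor
  · rw [gaussianReal_of_var_ne_zero _ one_ne_zero, gaussianPDF_def,
      integrable_withDensity_iff_integrable_smul' (by fun_prop) (by simp)]
    simp_rw [ENNReal.toReal_ofReal (gaussianPDFReal_nonneg _ _ _), hval]
    exact (integrable_exp_neg_mul_sq hb).const_mul _
  · rw [integral_gaussianReal_eq_integral_smul one_ne_zero]
    simp_rw [hval]
    rw [integral_const_mul, integral_gaussian]
    have h1 : (√(2 * Real.pi))⁻¹ * Real.exp (-x) * √(Real.pi / (1 / 2 - x))
        = Real.exp (-x) * (√(1 - 2 * x))⁻¹ := by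
      have : Real.pi / (1 / 2 - x) = (2 * Real.pi) * (1 - 2 * x)⁻¹ := by
        have : 1 - 2 * x ≠ 0 := by linarith
        field_simp
      rw [this, Real.sqrt_mul (x := 2 * Real.pi) (by positivity), Real.sqrt_inv]
      have : √(2 * Real.pi) ≠ 0 := by positivity
      field_simp
    rw [h1]
    have h2 : 0 < 1 - 2 * x := by linarith
    have h3 : (√(1 - 2 * x))⁻¹ = Real.exp (-(Real.log (1 - 2 * x) / 2)) := by
      rw [Real.exp_neg, ← Real.log_sqrt h2.le, Real.exp_log (Real.sqrt_pos.2 h2)]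
    rw [h3, ← Real.exp_add]
    apply Real.exp_le_exp.2
    have habs : |2 * x| ≤ 1 / 2 := by rw [abs_mul, abs_two]; linarith
    -- First-order expansion: `|log (1 - y) + y| ≤ y²/(1 - |y|) ≤ 2y²` at `y = 2x`. The linear term
    -- cancels `-x`, leaving `4x²`.
    have h4 := Real.abs_log_sub_add_sum_range_le (x := 2 * x) (by linarith) 1
    simp only [Finset.sum_range_one] at h4
    have h5 : |2 * x| ^ (1 + 1) / (1 - |2 * x|) ≤ 2 * (2 * x) ^ 2 := by
      rw [sq_abs, div_le_iff₀ (by linarith)]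
      nlinarith [sq_nonneg (2 * x)]
    have h6 := (abs_le.1 (h4.trans h5)).1
    norm_num at h6
    nlinarith

section StdGaussian

variable {d : ℕ}

lemma integral_stdGaussian (f : EuclideanSpace ℝ (Fin d) → ℝ) :
    ∫ z, f z ∂(stdGaussian (EuclideanSpace ℝ (Fin d)))
      = ∫ x, f (WithLp.toLp 2 x) ∂(Measure.pi fun _ : Fin d => gaussianReal 0 1) := by
  rw [← map_pi_eq_stdGaussian]
  exact integral_map_equiv (MeasurableEquiv.toLp 2 (Fin d → ℝ)) f

lemma measureReal_stdGaussian (s : Set (EuclideanSpace ℝ (Fin d))) :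
    (stdGaussian (EuclideanSpace ℝ (Fin d))).real s
      = (Measure.pi fun _ : Fin d => gaussianReal 0 1).real {x | WithLp.toLp 2 x ∈ s} := by
  rw [← map_pi_eq_stdGaussian, measureReal_def, measureReal_def]
  congr 1
  exact (MeasurableEquiv.toLp 2 (Fin d → ℝ)).map_apply s

/-- Chernoff bound for diagonal quadratic forms of a Gaussian vector. -/
lemma stdGaussian_quadratic_tail_le {a : Fin d → ℝ} {l t : ℝ} (ha : ∀ j, |l * a j| ≤ 1 / 4) :
    (stdGaussian (EuclideanSpace ℝ (Fin d))).real {z | l * t ≤ l * ∑ j, a j * (z j ^ 2 - 1)}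
      ≤ Real.exp (4 * l ^ 2 * ∑ j, a j ^ 2 - l * t) := by
  rw [measureReal_stdGaussian]
  have h := pi_measureReal_le_sum (ι := Fin d) (gaussianReal 0 1)
    (fun j g => l * a j * (g ^ 2 - 1)) (fun j => (gaussianReal_exp_mul_sq_sub_one (ha j)).1) (l * t)
  simp only [Set.mem_ofPred_eq, Finset.mul_sum, ← mul_assoc]
  refine h.trans ?_
  calc _ ≤ Real.exp (-(l * t)) * ∏ j, Real.exp (4 * (l * a j) ^ 2) := by
        gcongr with j
        exact (gaussianReal_exp_mul_sq_sub_one (ha j)).2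
    _ = _ := by
        rw [← Real.exp_sum, ← Real.exp_add]
        congr 1
        rw [sub_eq_neg_add]
        congr 1
        exact Finset.sum_congr rfl fun j _ => by ring

/-- Apply the one-sided bound to `a` and `-a`. The parameter `l` stays free so that callers can take
it as large as the sup norm of `a` permits. -/
lemma stdGaussian_abs_quadratic_tail_le {a : Fin d → ℝ} {l t : ℝ} (hl : 0 < l)
    (ha : ∀ j, l * |a j| ≤ 1 / 4) :
    (stdGaussian (EuclideanSpace ℝ (Fin d))).real {z | t ≤ |∑ j, a j * (z j ^ 2 - 1)|}
      ≤ 2 * Real.exp (4 * l ^ 2 * ∑ j, a j ^ 2 - l * t) := by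
  have h1 := stdGaussian_quadratic_tail_le (a := a) (l := l) (t := t)
    (fun j => by rw [abs_mul, abs_of_pos hl]; exact ha j)
  have h2 := stdGaussian_quadratic_tail_le (a := fun j => - a j) (l := l) (t := t)
    (fun j => by rw [abs_mul, abs_of_pos hl, abs_neg]; exact ha j)
  simp only [neg_sq, neg_mul, Finset.sum_neg_distrib] at h2
  simp only [mul_le_mul_iff_right₀ hl] at h1 h2
  have hsub : {z : EuclideanSpace ℝ (Fin d) | t ≤ |∑ j, a j * (z j ^ 2 - 1)|} ⊆
      {z | t ≤ ∑ j, a j * (z j ^ 2 - 1)} ∪ {z | t ≤ -∑ j, a j * (z j ^ 2 - 1)} := by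
    intro z hz
    simpa [le_abs] using hz
  have h3 := (measureReal_mono (μ := stdGaussian (EuclideanSpace ℝ (Fin d))) hsub).trans
    (measureReal_union_le _ _)
  linarith

lemma stdGaussian_abs_linear_tail_le {b : Fin d → ℝ} {l t : ℝ} (hl : 0 < l) :
    (stdGaussian (EuclideanSpace ℝ (Fin d))).real {z | t ≤ |∑ j, b j * z j|}
      ≤ 2 * Real.exp (l ^ 2 * (∑ j, b j ^ 2) / 2 - l * t) := by
  have key : ∀ b : Fin d → ℝ,
      (stdGaussian (EuclideanSpace ℝ (Fin d))).real {z | t ≤ ∑ j, b j * z j}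
      ≤ Real.exp (l ^ 2 * (∑ j, b j ^ 2) / 2 - l * t) := by
    intro b
    rw [measureReal_stdGaussian]
    have h := pi_measureReal_le_sum (ι := Fin d) (gaussianReal 0 1)
      (fun j g => (l * b j) * g) (fun j => integrable_exp_mul_gaussianReal _) (l * t)
    have hm : ∀ j, ∫ g, Real.exp ((l * b j) * g) ∂(gaussianReal 0 1)
        = Real.exp ((l * b j) ^ 2 / 2) := by
      intro j
      have := congrFun (mgf_id_gaussianReal (μ := 0) (v := 1)) (l * b j)
      simpa [mgf] using this
    simp only [hm] at h
    simp only [mul_assoc, ← Finset.mul_sum, mul_le_mul_iff_right₀ hl] at h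
    refine h.trans (le_of_eq ?_)
    rw [← Real.exp_sum, ← Real.exp_add, sub_eq_neg_add]
    congr 2
    rw [Finset.mul_sum, Finset.sum_div]
    exact Finset.sum_congr rfl fun j _ => by ring
  have h1 := key b
  have h2 := key fun j => - b j
  simp only [neg_sq, neg_mul, Finset.sum_neg_distrib] at h2
  have hsub : {z : EuclideanSpace ℝ (Fin d) | t ≤ |∑ j, b j * z j|} ⊆
      {z | t ≤ ∑ j, b j * z j} ∪ {z | t ≤ -∑ j, b j * z j} := by
    intro z hz
    simpa [le_abs] using hz
  have h3 := (measureReal_mono (μ := stdGaussian (EuclideanSpace ℝ (Fin d))) hsub).trans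
    (measureReal_union_le _ _)
  linarith

/-- Each coordinate contributes at most `e^{1/2}`: a factor `e^{1/4}` from uncentring the square and
`e^{4/16}` from the moment bound at `x = 1/4`. This controls the average feature norm through
Chernoff. -/
lemma stdGaussian_exp_norm_sq :
    Integrable (fun z => Real.exp (‖z‖ ^ 2 / 4)) (stdGaussian (EuclideanSpace ℝ (Fin d))) ∧
      ∫ z, Real.exp (‖z‖ ^ 2 / 4) ∂(stdGaussian (EuclideanSpace ℝ (Fin d))) ≤ Real.exp (d / 2) := by
  have h4 : |(1 / 4 : ℝ)| ≤ 1 / 4 := by norm_num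
  have hfun : ∀ x : Fin d → ℝ, Real.exp (‖(WithLp.toLp 2 x : EuclideanSpace ℝ (Fin d))‖ ^ 2 / 4)
      = Real.exp (d / 4) * ∏ j, Real.exp (1 / 4 * (x j ^ 2 - 1)) := by
    intro x
    rw [← Real.exp_sum, ← Real.exp_add, EuclideanSpace.real_norm_sq_eq, ← Finset.mul_sum,
      Finset.sum_sub_distrib]
    congr 1
    simp
    ring
  constructor
  · rw [← map_pi_eq_stdGaussian, integrable_map_measure (by fun_prop) (by fun_prop)]
    refine Integrable.congr ?_ (Filter.Eventually.of_forall fun x => (hfun x).symm)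
    exact (Integrable.fintype_prod fun j => (gaussianReal_exp_mul_sq_sub_one h4).1).const_mul _
  · rw [integral_stdGaussian]
    simp_rw [hfun]
    rw [integral_const_mul, integral_fintype_prod_eq_prod (μ := fun _ : Fin d => gaussianReal 0 1)
      (fun j x => Real.exp (1 / 4 * (x ^ 2 - 1))), Finset.prod_const]
    calc _ ≤ Real.exp (d / 4) * Real.exp (4 * (1 / 4) ^ 2) ^ (Finset.univ : Finset (Fin d)).card := by
          gcongr
          exact (gaussianReal_exp_mul_sq_sub_one h4).2
      _ = _ := by
          rw [← Real.exp_nat_mul, ← Real.exp_add]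
          congr 1
          simp
          ring

/-- The average squared norm of `n` Gaussian vectors is unlikely to exceed `M`. -/
lemma pi_stdGaussian_average_norm_sq_gt_le (n : ℕ) (hn : 0 < n) (M : ℝ) :
    (Measure.pi fun _ : Fin n => stdGaussian (EuclideanSpace ℝ (Fin d))).real
      {Z | M < (∑ i, ‖Z i‖ ^ 2) / n} ≤ Real.exp (n * (d / 2 - M / 4)) := by
  have hn' : (0 : ℝ) < n := by exact_mod_cast hn
  have h := pi_measureReal_le_sum (ι := Fin n) (stdGaussian (EuclideanSpace ℝ (Fin d)))
    (fun _ z => ‖z‖ ^ 2 / 4) (fun _ => stdGaussian_exp_norm_sq.1) (n * M / 4)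
  have hsub : {Z : Fin n → EuclideanSpace ℝ (Fin d) | M < (∑ i, ‖Z i‖ ^ 2) / n} ⊆
      {Z | n * M / 4 ≤ ∑ i, ‖Z i‖ ^ 2 / 4} := by
    intro Z hZ
    simp only [Set.mem_ofPred_eq] at hZ ⊢
    rw [lt_div_iff₀ hn'] at hZ
    rw [← Finset.sum_div]
    linarith
  refine (measureReal_mono hsub).trans (h.trans ?_)
  rw [Finset.prod_const, Finset.card_univ, Fintype.card_fin]
  calc _ ≤ Real.exp (-(n * M / 4)) * Real.exp (d / 2) ^ n := by
        gcongr
        exact stdGaussian_exp_norm_sq.2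
    _ = _ := by
        rw [← Real.exp_nat_mul, ← Real.exp_add]; congr 1; ring

lemma integral_inner_sq_stdGaussian (b : EuclideanSpace ℝ (Fin d)) :
    Integrable (fun z => inner ℝ b z ^ 2) (stdGaussian (EuclideanSpace ℝ (Fin d))) ∧
    ∫ z, inner ℝ b z ^ 2 ∂(stdGaussian (EuclideanSpace ℝ (Fin d))) = ‖b‖ ^ 2 := by
  have hmem : MemLp (innerSL ℝ b) 2 (stdGaussian (EuclideanSpace ℝ (Fin d))) :=
    IsGaussian.memLp_dual _ _ _ (by simp)
  have h := variance_dual_stdGaussian (E := EuclideanSpace ℝ (Fin d)) (innerSL ℝ b)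
  rw [variance_of_integral_eq_zero hmem.aestronglyMeasurable.aemeasurable
    (integral_strongDual_stdGaussian _)] at h
  refine ⟨?_, ?_⟩
  · exact hmem.integrable_sq
  · simpa using h

/-- Real part of the characteristic function multiplied by the phase `exp (ic)`. -/
lemma integral_cos_inner_add_stdGaussian (b : EuclideanSpace ℝ (Fin d)) (c : ℝ) :
    ∫ z, Real.cos (inner ℝ b z + c) ∂(stdGaussian (EuclideanSpace ℝ (Fin d)))
      = Real.exp (-‖b‖ ^ 2 / 2) * Real.cos c := by
  have h := charFun_stdGaussian (E := EuclideanSpace ℝ (Fin d)) b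
  rw [charFun_apply] at h
  have hInt : Integrable (fun z : EuclideanSpace ℝ (Fin d) =>
      Complex.exp ((inner ℝ z b : ℝ) * Complex.I) * Complex.exp (c * Complex.I))
      (stdGaussian (EuclideanSpace ℝ (Fin d))) := by
    refine Integrable.of_bound (Continuous.aestronglyMeasurable (by fun_prop)) 1
      (Filter.Eventually.of_forall fun z => ?_)
    simp [Complex.norm_exp_ofReal_mul_I]
  have h2 : ∫ z, (Complex.exp ((inner ℝ z b : ℝ) * Complex.I) * Complex.exp (c * Complex.I))
      ∂(stdGaussian (EuclideanSpace ℝ (Fin d)))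
      = Complex.exp (- ‖b‖ ^ 2 / 2) * Complex.exp (c * Complex.I) := by
    rw [integral_mul_const, h]
  have h3 := congrArg Complex.re h2
  rw [← RCLike.re_eq_complex_re, ← integral_re hInt] at h3
  have h4 : ∀ z : EuclideanSpace ℝ (Fin d), RCLike.re (K := ℂ)
      (Complex.exp ((inner ℝ z b : ℝ) * Complex.I) * Complex.exp (c * Complex.I))
      = Real.cos (inner ℝ b z + c) := by
    intro z
    rw [← Complex.exp_add, ← add_mul, ← Complex.ofReal_add, RCLike.re_eq_complex_re,
      Complex.exp_ofReal_mul_I_re, real_inner_comm]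
  simp_rw [h4] at h3
  rw [h3, RCLike.re_eq_complex_re]
  have h5 : Complex.exp (- (‖b‖ : ℂ) ^ 2 / 2) = ((Real.exp (-‖b‖ ^ 2 / 2) : ℝ) : ℂ) := by
    push_cast; rfl
  rw [h5, Complex.re_ofReal_mul, Complex.exp_ofReal_mul_I_re]

end StdGaussian

/-! ### The tests and their feature maps -/

noncomputable section

/-- The standard Gaussian measure on `ℝ^d`. -/
abbrev gaussianStd (d : ℕ) : Measure (EuclideanSpace ℝ (Fin d)) :=
  stdGaussian (EuclideanSpace ℝ (Fin d))

/-- The law of `n` independent standard Gaussian vectors. -/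
abbrev gaussianStdSamples (d n : ℕ) : Measure (Dataset d n) :=
  Measure.pi fun _ : Fin n => gaussianStd d

/-- Truncation to the interval `[-17, 17]`. -/
def clip (x : ℝ) : ℝ := max (-17) (min 17 x)

/-- The quadratic polynomial `∑ j, a j * z j ^ 2 + ∑ j, b j * z j + c`. -/
def diagQuad {d : ℕ} (a b : Fin d → ℝ) (c : ℝ) (z : EuclideanSpace ℝ (Fin d)) : ℝ :=
  ∑ j, a j * z j ^ 2 + ∑ j, b j * z j + c

/-- The empirical characteristic function is `ε`-close to that of the standard Gaussian on the
unit ball. -/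
def CosTest {d n : ℕ} (ε : ℝ) (Z : Dataset d n) : Prop :=
  ∀ b : EuclideanSpace ℝ (Fin d), ‖b‖ ≤ 1 → ∀ c : ℝ,
    |(∑ i, Real.cos (inner ℝ b (Z i) + c)) / n - Real.exp (-‖b‖ ^ 2 / 2) * Real.cos c| ≤ ε

/-- The empirical means of truncated quadratic polynomials are `ε`-close to the Gaussian means. -/
def ClipTest {d n : ℕ} (ε : ℝ) (Z : Dataset d n) : Prop :=
  ∀ (a b : Fin d → ℝ) (c : ℝ), (∀ j, |a j| ≤ 2) → (∀ j, |b j| ≤ 2) → |c| ≤ 4 * d →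
    |(∑ i, clip (diagQuad a b c (Z i))) / n - ∫ z, clip (diagQuad a b c z) ∂(gaussianStd d)| ≤ ε

/-- Centred quadratic polynomials with small coefficients exceed `ρ` on at most a quarter of the
data. -/
def CountTest {d n : ℕ} (ρ : ℝ) (Z : Dataset d n) : Prop :=
  ∀ a b : Fin d → ℝ, ∑ j, a j ^ 2 ≤ 4 → (∀ j, |a j| ≤ 1 / ρ) → ∑ j, b j ^ 2 ≤ 1 →
    ((Finset.univ.filter fun i => ρ < |diagQuad a b (-∑ j, a j) (Z i)|).card : ℝ) ≤ n / 4

/-- A dataset that looks standard Gaussian to all the tests, in every orthonormal basis. -/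
structure LooksGaussian {d n : ℕ} (γ ρ : ℝ) (Z : Dataset d n) : Prop where
  cosTest : CosTest γ Z
  clipTest : ρ ≤ 200 → ∀ U : EuclideanSpace ℝ (Fin d) ≃ₗᵢ[ℝ] EuclideanSpace ℝ (Fin d),
    ClipTest (ρ / 10 ^ 4) fun i => U (Z i)
  countTest : 200 < ρ → ∀ U : EuclideanSpace ℝ (Fin d) ≃ₗᵢ[ℝ] EuclideanSpace ℝ (Fin d),
    CountTest ρ fun i => U (Z i)

lemma abs_clip_sub_clip_le (x y : ℝ) : |clip x - clip y| ≤ |x - y| := by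
  unfold clip
  have h1 := abs_max_sub_max_le_max (-17 : ℝ) (min 17 x) (-17) (min 17 y)
  have h2 := abs_min_sub_min_le_max (17 : ℝ) x 17 y
  simp only [sub_self, abs_zero] at h1 h2
  exact h1.trans (max_le (abs_nonneg _) (h2.trans (max_le (abs_nonneg _) le_rfl)))

lemma abs_clip_le (x : ℝ) : |clip x| ≤ 17 := by
  unfold clip
  exact abs_le.2 ⟨le_max_left _ _, max_le (by norm_num) (min_le_left _ _)⟩

lemma continuous_clip : Continuous clip := by unfold clip; fun_prop

lemma continuous_diagQuad {d : ℕ} (a b : Fin d → ℝ) (c : ℝ) : Continuous (diagQuad a b c) := by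
  unfold diagQuad; fun_prop

variable {d n : ℕ}

/-- Constant and linear monomials. -/
def linearFeature (d : ℕ) : Option (Fin d) → EuclideanSpace ℝ (Fin d) → ℝ
  | none, _ => 1
  | some j, z => z j

/-- Monomials of degree at most two. -/
def quadFeature (d : ℕ) : Option (Fin d ⊕ Fin d × Fin d) → EuclideanSpace ℝ (Fin d) → ℝ
  | none, _ => 1
  | some (Sum.inl j), z => z j
  | some (Sum.inr p), z => z p.1 * z p.2

lemma measurable_linearFeature (j : Option (Fin d)) : Measurable (linearFeature d j) := by
  rcases j with _ | j
  · exact measurable_const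
  · exact Continuous.measurable (by unfold linearFeature; fun_prop)

lemma measurable_quadFeature (j : Option (Fin d ⊕ Fin d × Fin d)) :
    Measurable (quadFeature d j) := by
  rcases j with _ | j | p
  · exact measurable_const
  · exact Continuous.measurable (by unfold quadFeature; fun_prop)
  · exact Continuous.measurable (by unfold quadFeature; fun_prop)

lemma sum_abs_le_add_norm_sq (z : EuclideanSpace ℝ (Fin d)) : ∑ j, |z j| ≤ d + ‖z‖ ^ 2 := by
  rw [EuclideanSpace.real_norm_sq_eq]
  calc ∑ j, |z j| ≤ ∑ j : Fin d, (1 + z j ^ 2) := Finset.sum_le_sum fun j _ => by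
        rw [← sq_abs]; nlinarith [sq_nonneg (|z j| - 1), sq_nonneg (|z j|)]
    _ = _ := by rw [Finset.sum_add_distrib]; simp

/-- The `ℓ¹` norm of the features is the Lipschitz constant of the test function in its
coefficients, so its average governs the error of passing to a net. -/
lemma sum_abs_linearFeature_le (z : EuclideanSpace ℝ (Fin d)) :
    ∑ j, |linearFeature d j z| ≤ 1 + d + ‖z‖ ^ 2 := by
  rw [Fintype.sum_option]
  have := sum_abs_le_add_norm_sq z
  simp only [linearFeature, abs_one]
  linarith

lemma sum_abs_quadFeature_le (z : EuclideanSpace ℝ (Fin d)) :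
    ∑ j, |quadFeature d j z| ≤ 1 + d + (d + 1) * ‖z‖ ^ 2 := by
  rw [Fintype.sum_option, Fintype.sum_sum_type, Fintype.sum_prod_type]
  have h1 := sum_abs_le_add_norm_sq z
  have h2 : ∑ k, ∑ l, |z k * z l| ≤ d * ‖z‖ ^ 2 := by
    have : ∑ k, ∑ l, |z k * z l| = (∑ k, |z k|) ^ 2 := by
      rw [sq, Finset.sum_mul_sum]; simp_rw [abs_mul]
    rw [this, EuclideanSpace.real_norm_sq_eq]
    refine (sq_sum_le_card_mul_sum_sq).trans ?_
    simp
  simp only [quadFeature, abs_one]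
  linarith

lemma integrable_norm_sq_gaussianStd :
    Integrable (fun z => ‖z‖ ^ 2) (gaussianStd d) :=
  (IsGaussian.memLp_two_id (μ := gaussianStd d)).norm.integrable_sq

lemma integral_norm_sq_gaussianStd : ∫ z, ‖z‖ ^ 2 ∂(gaussianStd d) = d := by
  have hj : ∀ j : Fin d, ∀ z : EuclideanSpace ℝ (Fin d),
      z j ^ 2 = inner ℝ (EuclideanSpace.single j (1 : ℝ)) z ^ 2 := by
    intro j z; rw [EuclideanSpace.inner_single_left]; simp
  simp_rw [EuclideanSpace.real_norm_sq_eq, hj]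
  rw [integral_finsetSum _ fun j _ => (integral_inner_sq_stdGaussian _).1]
  simp [(integral_inner_sq_stdGaussian _).2]

/-- Integrability and moment bound for the `ℓ¹` norm of a feature map dominated by `A + B ‖z‖²`. -/
lemma integral_sum_abs_feature_le {ι : Type*} [Fintype ι]
    {Ψ : ι → EuclideanSpace ℝ (Fin d) → ℝ} (hΨ : ∀ j, Measurable (Ψ j)) {A B : ℝ}
    (h : ∀ z, ∑ j, |Ψ j z| ≤ A + B * ‖z‖ ^ 2) :
    Integrable (fun z => ∑ j, |Ψ j z|) (gaussianStd d) ∧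
      ∫ z, ∑ j, |Ψ j z| ∂(gaussianStd d) ≤ A + B * d := by
  have hi : Integrable (fun z => A + B * ‖z‖ ^ 2) (gaussianStd d) :=
    (integrable_const _).add (integrable_norm_sq_gaussianStd.const_mul _)
  have hI : Integrable (fun z => ∑ j, |Ψ j z|) (gaussianStd d) := by
    refine hi.mono'
      (Finset.measurable_sum _ fun j _ => (hΨ j).abs).aestronglyMeasurable
      (Filter.Eventually.of_forall fun z => ?_)
    rw [Real.norm_eq_abs, abs_of_nonneg (Finset.sum_nonneg fun j _ => abs_nonneg _)]
    exact h z
  refine ⟨hI, (integral_mono hI hi h).trans (le_of_eq ?_)⟩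
  rw [integral_add (integrable_const _) (integrable_norm_sq_gaussianStd.const_mul _),
    integral_const_mul, integral_norm_sq_gaussianStd]
  simp

/-- The average `ℓ¹` norm of features dominated by `A + B ‖z‖²` is small with high probability. -/
lemma average_sum_abs_feature_gt_le (hn : 0 < n) {ι : Type*} [Fintype ι]
    {Ψ : ι → EuclideanSpace ℝ (Fin d) → ℝ} {A B : ℝ} (hB : 0 < B)
    (h : ∀ z, ∑ j, |Ψ j z| ≤ A + B * ‖z‖ ^ 2) (M : ℝ) :
    (gaussianStdSamples d n).real {Z | A + B * M < (∑ i, ∑ j, |Ψ j (Z i)|) / n}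
      ≤ Real.exp (n * (d / 2 - M / 4)) := by
  refine (measureReal_mono ?_).trans (pi_stdGaussian_average_norm_sq_gt_le n hn M)
  intro Z hZ
  simp only [Set.mem_ofPred_eq] at hZ ⊢
  have hn' : (0 : ℝ) < n := by exact_mod_cast hn
  rw [lt_div_iff₀ hn'] at hZ ⊢
  have h1 : ∑ i, ∑ j, |Ψ j (Z i)| ≤ n * A + B * ∑ i, ‖Z i‖ ^ 2 := by
    calc _ ≤ ∑ i, (A + B * ‖Z i‖ ^ 2) := Finset.sum_le_sum fun i _ => h _
      _ = _ := by rw [Finset.sum_add_distrib, Finset.mul_sum]; simp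
  refine lt_of_mul_lt_mul_left (a := B) ?_ hB.le
  linarith

/-- A quadratic diagonal in a rotated basis is still a combination of the monomials of degree at
most two. One net of dimension `1 + d + d²` therefore serves all rotations `U` at once.
Orthonormality of the columns of `U` bounds the coefficients. -/
lemma exists_coeff_diagQuad (U : EuclideanSpace ℝ (Fin d) ≃ₗᵢ[ℝ] EuclideanSpace ℝ (Fin d))
    {a b : Fin d → ℝ} {c : ℝ} (ha : ∀ j, |a j| ≤ 2) (hb : ∀ j, |b j| ≤ 2) (hc : |c| ≤ 4 * d) :
    ∃ w : Option (Fin d ⊕ Fin d × Fin d) → ℝ, (∀ j, |w j| ≤ 4 * d) ∧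
      ∀ z, ∑ j, w j * quadFeature d j z = diagQuad a b c (U z) := by
  let u : Fin d → Fin d → ℝ := fun j k => U (EuclideanSpace.single k 1) j
  have hu : ∀ z j, U z j = ∑ k, u j k * z k := by
    intro z j
    have hz : z = ∑ k, z k • EuclideanSpace.single k (1 : ℝ) := by
      ext i; simp [Finset.sum_apply, Pi.single_apply]
    conv_lhs => rw [hz, map_sum]
    simp [u, mul_comm]
  have hun : ∀ k, ∑ j, u j k ^ 2 = 1 := by
    intro k
    have : ‖U (EuclideanSpace.single k (1 : ℝ))‖ ^ 2 = 1 := by simp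
    rw [EuclideanSpace.real_norm_sq_eq] at this
    exact this
  have hu1 : ∀ j k, |u j k| ≤ 1 := by
    intro j k
    rw [← sq_le_one_iff_abs_le_one, ← hun k]
    exact Finset.single_le_sum (f := fun j => u j k ^ 2) (fun j _ => sq_nonneg _)
      (Finset.mem_univ j)
  let w : Option (Fin d ⊕ Fin d × Fin d) → ℝ := fun o => match o with
    | none => c
    | some (Sum.inl k) => ∑ j, b j * u j k
    | some (Sum.inr p) => ∑ j, a j * (u j p.1 * u j p.2)
  refine ⟨w, ?_, ?_⟩
  · rintro (_ | k | ⟨k, l⟩)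
    · exact hc
    · have : ∑ j, |b j * u j k| ≤ ∑ _j : Fin d, 2 := Finset.sum_le_sum fun j _ => by
        rw [abs_mul]; nlinarith [hb j, hu1 j k, abs_nonneg (b j), abs_nonneg (u j k)]
      refine (Finset.abs_sum_le_sum_abs _ _).trans (this.trans ?_)
      simp; nlinarith [(Nat.cast_nonneg d : (0 : ℝ) ≤ d)]
    · have hd : (1 : ℝ) ≤ d := by
        have : 0 < d := k.pos
        exact_mod_cast this
      have : ∑ j, |a j * (u j k * u j l)| ≤ ∑ j, (u j k ^ 2 + u j l ^ 2) :=
        Finset.sum_le_sum fun j _ => by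
          rw [abs_mul, abs_mul, ← sq_abs (u j k), ← sq_abs (u j l)]
          nlinarith [ha j, sq_nonneg (|u j k| - |u j l|),
            mul_nonneg (abs_nonneg (u j k)) (abs_nonneg (u j l))]
      refine (Finset.abs_sum_le_sum_abs _ _).trans (this.trans ?_)
      rw [Finset.sum_add_distrib, hun, hun]
      linarith
  · intro z
    rw [Fintype.sum_option, Fintype.sum_sum_type, Fintype.sum_prod_type]
    simp only [w, quadFeature, diagQuad, hu]
    have h1 : ∑ k, (∑ j, b j * u j k) * z k = ∑ j, b j * ∑ k, u j k * z k := by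
      simp_rw [Finset.sum_mul, Finset.mul_sum]
      rw [Finset.sum_comm]
      simp_rw [mul_assoc]
    have h2 : ∑ k, ∑ l, (∑ j, a j * (u j k * u j l)) * (z k * z l)
        = ∑ j, a j * (∑ k, u j k * z k) ^ 2 := by
      simp_rw [sq, Finset.sum_mul_sum, Finset.mul_sum, Finset.sum_mul]
      calc _ = ∑ k, ∑ j, ∑ l, a j * (u j k * u j l) * (z k * z l) :=
            Finset.sum_congr rfl fun k _ => Finset.sum_comm
        _ = ∑ j, ∑ k, ∑ l, a j * (u j k * u j l) * (z k * z l) := Finset.sum_comm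
        _ = _ := by
            refine Finset.sum_congr rfl fun j _ => Finset.sum_congr rfl fun k _ =>
              Finset.sum_congr rfl fun l _ => by ring
    rw [h1, h2]
    ring

lemma integral_comp_isometry_gaussianStd
    (U : EuclideanSpace ℝ (Fin d) ≃ₗᵢ[ℝ] EuclideanSpace ℝ (Fin d))
    (f : EuclideanSpace ℝ (Fin d) → ℝ) :
    ∫ z, f (U z) ∂(gaussianStd d) = ∫ z, f z ∂(gaussianStd d) := by
  conv_rhs => rw [gaussianStd, ← stdGaussian_map U]
  exact (integral_map_equiv U.toHomeomorph.toMeasurableEquiv f).symm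

lemma measureReal_preimage_isometry_gaussianStd
    (U : EuclideanSpace ℝ (Fin d) ≃ₗᵢ[ℝ] EuclideanSpace ℝ (Fin d))
    (s : Set (EuclideanSpace ℝ (Fin d))) :
    (gaussianStd d).real {z | U z ∈ s} = (gaussianStd d).real s := by
  conv_rhs => rw [gaussianStd, ← stdGaussian_map U]
  rw [measureReal_def, measureReal_def]
  congr 1
  exact (U.toHomeomorph.toMeasurableEquiv.map_apply s).symm

/-! ### Failure probabilities of the tests -/

/-- Failure probability of `CosTest`. -/
lemma measureReal_not_cosTest_le (hn : 0 < n) {γ M : ℝ} (hγ : 0 < γ) (hγ1 : γ ≤ 1)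
    (hM : (d : ℝ) ≤ M) :
    (gaussianStdSamples d n).real {Z | ¬ CosTest γ Z} ≤ Real.exp (n * (d / 2 - M / 4)) +
      (112 * (1 + d + M) / γ) ^ (d + 1) * (2 * Real.exp (-(n * γ ^ 2 / 8))) := by
  have hd : (0 : ℝ) ≤ d := Nat.cast_nonneg d
  set M' := 1 + d + 1 * M with hM'
  have hM'1 : 1 ≤ M' := by rw [hM']; linarith
  have hdom : ∀ z : EuclideanSpace ℝ (Fin d),
      ∑ j, |linearFeature d j z| ≤ (1 + d) + 1 * ‖z‖ ^ 2 := fun z => by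
    simpa using sum_abs_linearFeature_le z
  have hInt := integral_sum_abs_feature_le measurable_linearFeature hdom
  have hcos : ∀ x y : ℝ, |Real.cos x - Real.cos y| ≤ |x - y| := fun x y =>
    Real.abs_cos_sub_cos_le x y
  have h := pi_measureReal_uniform_mean_deviation_le (gaussianStd d) hn
    (measurable_linearFeature (d := d)) hcos one_pos Real.abs_cos_le_one (R := 7)
    (δ := γ / (4 * M')) (M := M') (ε := γ / 2) (by positivity)
    (by rw [div_le_iff₀ (by positivity)]; linarith) (by positivity) hInt.1
    (hInt.2.trans (by rw [hM']; linarith))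
  have h2 := average_sum_abs_feature_gt_le (n := n) hn one_pos hdom M
  rw [← hM'] at h2
  -- Half of the tolerance goes to the deviation at net points, half to discretization. This fixes
  -- `δ = γ/(4M')`.
  have hε : γ / 2 + 2 * (γ / (4 * M')) * M' = γ := by field_simp; norm_num
  rw [hε] at h
  have hsub : {Z : Dataset d n | ¬ CosTest γ Z} ⊆
      {Z | ∃ a : Option (Fin d) → ℝ, (∀ j, |a j| ≤ 7) ∧
        γ < |(∑ i, Real.cos (∑ j, a j * linearFeature d j (Z i))) / n -
          ∫ x, Real.cos (∑ j, a j * linearFeature d j x) ∂(gaussianStd d)|} := by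
    intro Z hZ
    simp only [Set.mem_ofPred_eq, CosTest] at hZ
    push Not at hZ
    obtain ⟨b, hb, c, hc⟩ := hZ
    -- The phase is unbounded in the test; reduced modulo `2π` it lies in `[0, 7]` and fits into the
    -- net.
    obtain ⟨c', hc', k, hk⟩ : ∃ c' : ℝ, |c'| ≤ 7 ∧ ∃ k : ℤ, c' = c - k * (2 * Real.pi) := by
      refine ⟨toIcoMod Real.two_pi_pos 0 c, ?_, toIcoDiv Real.two_pi_pos 0 c, ?_⟩
      · have := toIcoMod_mem_Ico Real.two_pi_pos 0 c
        rw [abs_of_nonneg this.1]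
        linarith [this.2, Real.pi_lt_d2]
      · rw [← zsmul_eq_mul]; rfl
    have hper : ∀ x : ℝ, Real.cos (x + c') = Real.cos (x + c) := by
      intro x
      rw [hk, ← add_sub_assoc, Real.cos_sub_int_mul_two_pi]
    refine ⟨fun o => o.elim c' b, ?_, ?_⟩
    · rintro (_ | j)
      · exact hc'
      · have h3 := EuclideanSpace.real_norm_sq_eq b
        have h4 : b j ^ 2 ≤ ∑ j, b j ^ 2 :=
          Finset.single_le_sum (f := fun j => b j ^ 2) (fun j _ => sq_nonneg _) (Finset.mem_univ j)
        have h5 : |b j| ^ 2 ≤ ‖b‖ ^ 2 := by rw [sq_abs, h3]; exact h4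
        have := abs_le_of_sq_le_sq' h5 (norm_nonneg b)
        simp only [Option.elim]
        linarith [this.2]
    · have hs : ∀ z : EuclideanSpace ℝ (Fin d),
          ∑ j, (fun o : Option (Fin d) => o.elim c' b) j * linearFeature d j z
            = inner ℝ b z + c' := by
        intro z
        rw [Fintype.sum_option]
        simp only [linearFeature, Option.elim, mul_one, PiLp.inner_apply]
        rw [add_comm]
        simp [mul_comm]
      simp only [hs, hper, integral_cos_inner_add_stdGaussian]
      exact hc
  refine (measureReal_mono hsub).trans (h.trans ?_)
  have e1 : 4 * 7 / (γ / (4 * M')) = 112 * (1 + d + M) / γ := by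
    rw [hM']; field_simp; ring
  have e2 : n * (γ / 2) ^ 2 / (2 * 1 ^ 2) = n * γ ^ 2 / 8 := by ring
  rw [e1, e2, Fintype.card_option, Fintype.card_fin]
  linarith

/-- Failure probability of `ClipTest`. -/
lemma measureReal_not_clipTest_le (hn : 0 < n) (hd : 0 < d) {ε M : ℝ} (hε : 0 < ε) (hε1 : ε ≤ 1)
    (hM : (d : ℝ) ≤ M) :
    (gaussianStdSamples d n).real
        {Z | ¬ ∀ U : EuclideanSpace ℝ (Fin d) ≃ₗᵢ[ℝ] EuclideanSpace ℝ (Fin d),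
          ClipTest ε fun i => U (Z i)} ≤ Real.exp (n * (d / 2 - M / 4)) +
      (64 * d * (1 + d + (d + 1) * M) / ε) ^ (d + d * d + 1) *
        (2 * Real.exp (-(n * ε ^ 2 / 2312))) := by
  have hd' : (1 : ℝ) ≤ d := by exact_mod_cast hd
  set M' := 1 + d + (d + 1) * M with hM'
  have hM'1 : 1 ≤ M' := by rw [hM']; nlinarith
  have hInt := integral_sum_abs_feature_le measurable_quadFeature (sum_abs_quadFeature_le (d := d))
  have h := pi_measureReal_uniform_mean_deviation_le (gaussianStd d) hn
    (measurable_quadFeature (d := d)) abs_clip_sub_clip_le (B := 17) (by norm_num) abs_clip_le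
    (R := 4 * d) (δ := ε / (4 * M')) (M := M') (ε := ε / 2) (by positivity)
    (by rw [div_le_iff₀ (by positivity)]; nlinarith) (by positivity) hInt.1
    (hInt.2.trans (by rw [hM']; nlinarith))
  have h2 := average_sum_abs_feature_gt_le (n := n) hn (by positivity)
    (sum_abs_quadFeature_le (d := d)) M
  rw [← hM'] at h2
  have hε : ε / 2 + 2 * (ε / (4 * M')) * M' = ε := by field_simp; norm_num
  rw [hε] at h
  have hsub : {Z : Dataset d n | ¬ ∀ U : EuclideanSpace ℝ (Fin d) ≃ₗᵢ[ℝ] EuclideanSpace ℝ (Fin d),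
          ClipTest ε fun i => U (Z i)} ⊆
      {Z | ∃ w : Option (Fin d ⊕ Fin d × Fin d) → ℝ, (∀ j, |w j| ≤ 4 * d) ∧
        ε < |(∑ i, clip (∑ j, w j * quadFeature d j (Z i))) / n -
          ∫ x, clip (∑ j, w j * quadFeature d j x) ∂(gaussianStd d)|} := by
    intro Z hZ
    simp only [Set.mem_ofPred_eq, ClipTest] at hZ
    push Not at hZ
    obtain ⟨U, a, b, c, ha, hb, hc, hlt⟩ := hZ
    obtain ⟨w, hw, hwz⟩ := exists_coeff_diagQuad U ha hb hc
    refine ⟨w, hw, ?_⟩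
    simp only [hwz]
    rwa [integral_comp_isometry_gaussianStd U fun z => clip (diagQuad a b c z)]
  refine (measureReal_mono hsub).trans (h.trans ?_)
  have e1 : 4 * (4 * d) / (ε / (4 * M')) = 64 * d * M' / ε := by
    field_simp; ring
  have e2 : n * (ε / 2) ^ 2 / (2 * 17 ^ 2) = n * ε ^ 2 / 2312 := by ring
  rw [e1, e2]
  simp only [Fintype.card_option, Fintype.card_sum, Fintype.card_prod, Fintype.card_fin]
  linarith

lemma diagQuad_neg_sum (a b : Fin d → ℝ) (z : EuclideanSpace ℝ (Fin d)) :
    diagQuad a b (-∑ j, a j) z = ∑ j, a j * (z j ^ 2 - 1) + ∑ j, b j * z j := by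
  unfold diagQuad
  simp_rw [mul_sub, Finset.sum_sub_distrib, mul_one]
  ring

/-- Tail bound for the polynomials in `CountTest`. -/
lemma gaussianStd_diagQuad_tail_le {ρ : ℝ} (hρ : 0 < ρ) {a b : Fin d → ℝ} (ha : ∑ j, a j ^ 2 ≤ 4)
    (ha' : ∀ j, |a j| ≤ 1 / ρ) (hb : ∑ j, b j ^ 2 ≤ 1) :
    (gaussianStd d).real {z | ρ / 2 < |diagQuad a b (-∑ j, a j) z|}
      ≤ Real.exp (-(ρ ^ 2 / 1024 - 2)) := by
  -- With `∑ a j² ≤ 4` the exponent is at most `ρ²/1024 - ρ²/512 = -ρ²/1024`. The bound `|a j| ≤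
  -- 1/ρ` is what allows `l` of order `ρ`.
  have h1 := stdGaussian_abs_quadratic_tail_le (a := a) (l := ρ / 128) (t := ρ / 4) (by positivity)
    (fun j => by
      have := mul_le_mul_of_nonneg_left (ha' j) (by positivity : 0 ≤ ρ / 128)
      refine this.trans (le_of_eq_of_le (b := 1 / 128) (by field_simp) (by norm_num)))
  have h2 := stdGaussian_abs_linear_tail_le (b := b) (l := ρ / 4) (t := ρ / 4) (by positivity)
  have hsub : {z : EuclideanSpace ℝ (Fin d) | ρ / 2 < |diagQuad a b (-∑ j, a j) z|} ⊆
      {z | ρ / 4 ≤ |∑ j, a j * (z j ^ 2 - 1)|} ∪ {z | ρ / 4 ≤ |∑ j, b j * z j|} := by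
    intro z hz
    simp only [Set.mem_ofPred_eq, Set.mem_union, diagQuad_neg_sum] at hz ⊢
    by_contra hcon
    push Not at hcon
    linarith [abs_add_le (∑ j, a j * (z j ^ 2 - 1)) (∑ j, b j * z j)]
  have h3 := (measureReal_mono (μ := gaussianStd d) hsub).trans (measureReal_union_le _ _)
  have e1 : Real.exp (4 * (ρ / 128) ^ 2 * ∑ j, a j ^ 2 - ρ / 128 * (ρ / 4))
      ≤ Real.exp (-(ρ ^ 2 / 1024)) := by
    apply Real.exp_le_exp.2
    nlinarith [mul_le_mul_of_nonneg_left ha (by positivity : 0 ≤ 4 * (ρ / 128) ^ 2)]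
  have e2 : Real.exp ((ρ / 4) ^ 2 * (∑ j, b j ^ 2) / 2 - ρ / 4 * (ρ / 4))
      ≤ Real.exp (-(ρ ^ 2 / 1024)) := by
    apply Real.exp_le_exp.2
    nlinarith [mul_le_mul_of_nonneg_left hb (by positivity : 0 ≤ (ρ / 4) ^ 2), sq_nonneg ρ]
  have e3 : 4 * Real.exp (-(ρ ^ 2 / 1024)) ≤ Real.exp (-(ρ ^ 2 / 1024 - 2)) := by
    rw [neg_sub, sub_eq_add_neg, Real.exp_add]
    have : (4 : ℝ) ≤ Real.exp 2 := by
      have h := Real.add_one_le_exp (1 : ℝ)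
      have : Real.exp 2 = Real.exp 1 * Real.exp 1 := by rw [← Real.exp_add]; norm_num
      nlinarith
    gcongr
  linarith

/-- Failure probability of `CountTest`. -/
lemma measureReal_not_countTest_le (hn : 0 < n) (hd : 0 < d) {ρ M : ℝ} (hρ : 1 ≤ ρ) (hρd : ρ ≤ d)
    (hM : (d : ℝ) ≤ M) :
    (gaussianStdSamples d n).real
        {Z | ¬ ∀ U : EuclideanSpace ℝ (Fin d) ≃ₗᵢ[ℝ] EuclideanSpace ℝ (Fin d),
          CountTest ρ fun i => U (Z i)} ≤ Real.exp (n * (d / 2 - M / 4)) +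
      (256 * d * (1 + d + (d + 1) * M) / ρ) ^ (d + d * d + 1) *
        Real.exp (n * (1 - (ρ ^ 2 / 1024 - 2) / 8)) := by
  have hd' : (1 : ℝ) ≤ d := by exact_mod_cast hd
  have hρ0 : 0 < ρ := by linarith
  set M' := 1 + d + (d + 1) * M with hM'
  have hM'1 : 1 ≤ M' := by rw [hM']; nlinarith
  -- The class keeps only coefficient vectors of genuine test polynomials, for which the Gaussian
  -- tail bound is available; net points are chosen in `S` and inherit it.
  let S : Set (Option (Fin d ⊕ Fin d × Fin d) → ℝ) := {w | (∀ j, |w j| ≤ 4 * d) ∧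
    ∃ (U : EuclideanSpace ℝ (Fin d) ≃ₗᵢ[ℝ] EuclideanSpace ℝ (Fin d)) (a b : Fin d → ℝ),
      ∑ j, a j ^ 2 ≤ 4 ∧ (∀ j, |a j| ≤ 1 / ρ) ∧ ∑ j, b j ^ 2 ≤ 1 ∧
      ∀ z, ∑ j, w j * quadFeature d j z = diagQuad a b (-∑ j, a j) (U z)}
  have h := pi_measureReal_uniform_count_le (gaussianStd d) hn
    (measurable_quadFeature (d := d)) (S := S) (R := 4 * d) (δ := ρ / (16 * M')) (M := M')
    (τ := ρ / 2) (s := ρ ^ 2 / 1024 - 2) (fun w hw => hw.1) (by positivity)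
    (by rw [div_le_iff₀ (by positivity)]; nlinarith) (by positivity)
    (by field_simp; norm_num) (by
      rintro w ⟨-, U, a, b, ha, ha', hb, hw⟩
      simp only [hw]
      have := measureReal_preimage_isometry_gaussianStd U
        {z | ρ / 2 < |diagQuad a b (-∑ j, a j) z|}
      refine (le_of_eq this).trans (gaussianStd_diagQuad_tail_le hρ0 ha ha' hb))
  have h2 := average_sum_abs_feature_gt_le (n := n) hn (by positivity)
    (sum_abs_quadFeature_le (d := d)) M
  rw [← hM'] at h2
  have hsub : {Z : Dataset d n | ¬ ∀ U : EuclideanSpace ℝ (Fin d) ≃ₗᵢ[ℝ] EuclideanSpace ℝ (Fin d),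
          CountTest ρ fun i => U (Z i)} ⊆
      {Z | ∃ w ∈ S, (n : ℝ) / 4 < ((Finset.univ.filter fun i =>
          2 * (ρ / 2) < |∑ j, w j * quadFeature d j (Z i)|).card : ℝ)} := by
    intro Z hZ
    simp only [Set.mem_ofPred_eq, CountTest] at hZ
    push Not at hZ
    obtain ⟨U, a, b, ha, ha', hb, hlt⟩ := hZ
    have ha1 : ∀ j, |a j| ≤ 1 := fun j => (ha' j).trans ((div_le_one hρ0).2 hρ)
    have hb1 : ∀ j, |b j| ≤ 1 := by
      intro j
      rw [← sq_le_one_iff_abs_le_one]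
      exact (Finset.single_le_sum (f := fun j => b j ^ 2) (fun j _ => sq_nonneg _)
        (Finset.mem_univ j)).trans hb
    have hc : |-∑ j, a j| ≤ 4 * d := by
      rw [abs_neg]
      refine (Finset.abs_sum_le_sum_abs _ _).trans
        ((Finset.sum_le_sum fun j _ => ha1 j).trans ?_)
      simp; linarith
    obtain ⟨w, hw, hwz⟩ := exists_coeff_diagQuad U (fun j => (ha1 j).trans one_le_two)
      (fun j => (hb1 j).trans one_le_two) hc
    refine ⟨w, ⟨hw, U, a, b, ha, ha', hb, hwz⟩, ?_⟩
    have e : 2 * (ρ / 2) = ρ := by ring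
    simp only [hwz, e]
    exact hlt
  refine (measureReal_mono hsub).trans (h.trans ?_)
  have e1 : 4 * (4 * d) / (ρ / (16 * M')) = 256 * d * M' / ρ := by
    field_simp; ring
  rw [e1]
  simp only [Fintype.card_option, Fintype.card_sum, Fintype.card_prod, Fintype.card_fin]
  linarith

end

/-! ### The sample size suffices for all tests -/

noncomputable section

lemma exp_neg_three_le : Real.exp (-3) ≤ 1 / 8 := by
  rw [Real.exp_neg, ← one_div]
  refine one_div_le_one_div_of_le (by norm_num) ?_
  have h4 := Real.add_one_le_exp (1 : ℝ)
  have h5 : Real.exp 3 = Real.exp 1 ^ 3 := by rw [← Real.exp_nat_mul]; norm_num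
  rw [h5]
  calc (8 : ℝ) = 2 ^ 3 := by norm_num
    _ ≤ _ := pow_le_pow_left₀ (by norm_num) (by linarith) 3

/-- A union bound over `x ^ N` events of probability `2 exp (-t)`. -/
lemma pow_mul_two_mul_exp_le {x l t β : ℝ} (N : ℕ) (hx : 0 < x) (hβ : 0 < β)
    (hl : Real.log x ≤ l) (h : N * l + Real.log (1 / β) + 3 ≤ t) :
    x ^ N * (2 * Real.exp (-t)) ≤ β / 4 := by
  have h1 : x ^ N ≤ Real.exp (N * l) := by
    rw [Real.exp_nat_mul]
    refine pow_le_pow_left₀ hx.le ?_ N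
    rw [← Real.exp_log hx]
    exact Real.exp_le_exp.2 hl
  have h2 : Real.exp (N * l) * Real.exp (-t) ≤ β * Real.exp (-3) := by
    have hb : β = Real.exp (-Real.log (1 / β)) := by
      rw [one_div, Real.log_inv, neg_neg, Real.exp_log hβ]
    conv_rhs => rw [hb]
    rw [← Real.exp_add, ← Real.exp_add]
    exact Real.exp_le_exp.2 (by linarith)
  calc x ^ N * (2 * Real.exp (-t)) ≤ Real.exp (N * l) * (2 * Real.exp (-t)) := by gcongr
    _ = 2 * (Real.exp (N * l) * Real.exp (-t)) := by ring
    _ ≤ 2 * (β * (1 / 8)) := by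
        have := mul_le_mul_of_nonneg_left exp_neg_three_le hβ.le
        linarith
    _ = _ := by ring

set_option maxHeartbeats 600000 in
/-- Standard Gaussian samples pass all the tests with probability at least `1 - β`. -/
lemma measureReal_not_looksGaussian_le {d n : ℕ} {γ ρ β f : ℝ} (hγ : 0 < γ) (hγ1 : γ ≤ 1 / 10 ^ 5)
    (hβ : 0 < β) (hβ1 : β < 1) (hρ : 0 < ρ) (hρd : ρ ≤ √d)
    (hf1 : (d + Real.log (1 / β)) / γ ^ 2 ≤ f) (hf2 : (d + Real.log (1 / β)) ^ 2 / ρ ^ 2 ≤ f)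
    (hn : 10 ^ 14 * f * Real.log f ≤ n) :
    (gaussianStdSamples d n).real {Z | ¬ LooksGaussian γ ρ Z} ≤ β := by
  have hd0 : 0 < d := by
    rcases Nat.eq_zero_or_pos d with h | h
    · subst h; simp at hρd; linarith
    · exact h
  have hd : (1 : ℝ) ≤ d := by exact_mod_cast hd0
  set L := Real.log (1 / β) with hL
  have hL0 : 0 < L := Real.log_pos (by rw [lt_div_iff₀ hβ]; linarith)
  set D := (d : ℝ) + L with hD
  have hD1 : 1 ≤ D := by linarith
  have hg2 : 0 < γ ^ 2 := by positivity
  have hr2 : 0 < ρ ^ 2 := by positivity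
  have hf1' : D ≤ f * γ ^ 2 := (div_le_iff₀ hg2).1 hf1
  have hf2' : D ^ 2 ≤ f * ρ ^ 2 := (div_le_iff₀ hr2).1 hf2
  have hgsq : γ ^ 2 ≤ 1 / 10 ^ 10 := by
    calc γ ^ 2 ≤ (1 / 10 ^ 5) ^ 2 := pow_le_pow_left₀ hγ.le hγ1 2
      _ = _ := by norm_num
  have hf0 : 0 < f := by
    refine pos_of_mul_pos_left (b := γ ^ 2) ?_ hg2.le
    linarith
  have hfD : 10 ^ 10 * D ≤ f := by linarith [mul_le_mul_of_nonneg_left hgsq hf0.le]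
  have hf10 : 10 ^ 10 ≤ f := by linarith
  have hDf : D ≤ f := by linarith
  set l := Real.log f with hl
  have hl1 : 1 ≤ l := by
    rw [hl, Real.le_log_iff_exp_le hf0]
    linarith [Real.exp_one_lt_d9]
  have hnγ : 10 ^ 14 * D * l ≤ n * γ ^ 2 := by
    calc 10 ^ 14 * D * l ≤ 10 ^ 14 * (f * γ ^ 2) * l := by gcongr
      _ = (10 ^ 14 * f * l) * γ ^ 2 := by ring
      _ ≤ _ := by gcongr
  have hnρ : 10 ^ 14 * D ^ 2 * l ≤ n * ρ ^ 2 := by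
    calc 10 ^ 14 * D ^ 2 * l ≤ 10 ^ 14 * (f * ρ ^ 2) * l := by gcongr
      _ = (10 ^ 14 * f * l) * ρ ^ 2 := by ring
      _ ≤ _ := by gcongr
  have hn4 : (4 : ℝ) ≤ n := by linarith [mul_le_mul_of_nonneg_left hl1 hf0.le]
  have hn0 : 0 < n := by
    have : (0 : ℝ) < n := by linarith
    exact_mod_cast this
  have hiγ : 1 / γ ≤ f := by
    rw [div_le_iff₀ hγ]
    have : γ ^ 2 ≤ γ := by rw [sq]; exact mul_le_of_le_one_left hγ.le (by linarith)
    linarith [mul_le_mul_of_nonneg_left this hf0.le]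
  have hiρ : 1 / ρ ≤ f := by
    rw [div_le_iff₀ hρ]
    rcases le_total ρ 1 with h | h
    · have : ρ ^ 2 ≤ ρ := by rw [sq]; exact mul_le_of_le_one_left hρ.le h
      linarith [mul_le_mul_of_nonneg_left this hf0.le, one_le_pow₀ hD1 (n := 2)]
    · linarith [mul_le_mul_of_nonneg_left h hf0.le]
  -- The budget: each test fails with probability at most `β/2`, of which `β/4` is for a large
  -- average norm (with `M = 4D`) and `β/4` for the union bound over the net. Only two tests are
  -- active for a given `ρ`.
  have hfirst : Real.exp (n * (d / 2 - (4 * D) / 4)) ≤ β / 4 := by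
    have hb : β = Real.exp (-L) := by
      rw [hL, one_div, Real.log_inv, neg_neg, Real.exp_log hβ]
    have h2 : Real.exp (-2) ≤ 1 / 4 := by
      rw [Real.exp_neg, ← one_div]
      refine one_div_le_one_div_of_le (by norm_num) ?_
      have h4 := Real.add_one_le_exp (1 : ℝ)
      have h5 : Real.exp 2 = Real.exp 1 * Real.exp 1 := by rw [← Real.exp_add]; norm_num
      nlinarith
    calc _ ≤ Real.exp (-L + -2) := by
          apply Real.exp_le_exp.2
          rw [hD]
          have h6 : (4 : ℝ) * 1 ≤ n * d := mul_le_mul hn4 hd zero_le_one (by linarith)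
          have h7 : 1 * L ≤ n * L := mul_le_mul_of_nonneg_right (by linarith) hL0.le
          linarith
      _ = β * Real.exp (-2) := by rw [Real.exp_add, ← hb]
      _ ≤ β * (1 / 4) := by gcongr
      _ = _ := by ring
  have hDD : D ≤ D ^ 2 := le_self_pow₀ hD1 two_ne_zero
  have hcos : (gaussianStdSamples d n).real {Z | ¬ CosTest γ Z} ≤ β / 2 := by
    have h := measureReal_not_cosTest_le (d := d) (M := 4 * D) hn0 hγ (by linarith [hγ1])
      (by linarith)
    have hx : Real.log (112 * (1 + d + 4 * D) / γ) ≤ 3 * l := by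
      have : 3 * l = Real.log (f ^ 3) := by rw [Real.log_pow, hl]; norm_num
      rw [this]
      refine Real.log_le_log (by positivity) ?_
      calc 112 * (1 + d + 4 * D) / γ = 112 * (1 + d + 4 * D) * (1 / γ) := by ring
        _ ≤ 112 * (6 * f) * f := by gcongr; linarith
        _ = 672 * f ^ 2 := by ring
        _ ≤ f * f ^ 2 := by gcongr; linarith
        _ = _ := by ring
    have h2 := pow_mul_two_mul_exp_le (d + 1) (t := n * γ ^ 2 / 8) (by positivity) hβ hx (by
      push_cast
      rw [← hL]
      have h3 : (d : ℝ) * l ≤ D * l := by gcongr; linarith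
      have h4 : 1 * l ≤ D * l := by gcongr
      have h5 : D * 1 ≤ D * l := by gcongr
      linarith)
    linarith
  have hM' : 1 + (d : ℝ) + (d + 1) * (4 * D) ≤ 10 * D ^ 2 := by
    have : ((d : ℝ) + 1) * (4 * D) ≤ (2 * D) * (4 * D) := by gcongr; linarith
    linarith
  have hN : ((d + d * d + 1 : ℕ) : ℝ) ≤ 3 * D ^ 2 := by
    push_cast
    have : (d : ℝ) * d ≤ D * D := by gcongr <;> linarith
    linarith
  have hNl : ((d + d * d + 1 : ℕ) : ℝ) * (5 * l) + L + 3 ≤ 19 * D ^ 2 * l := by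
    have := mul_le_mul_of_nonneg_right hN (by linarith : 0 ≤ 5 * l)
    have h5 : D ^ 2 * 1 ≤ D ^ 2 * l := by gcongr
    linarith
  have hlog5 : 5 * l = Real.log (f ^ 5) := by rw [Real.log_pow, hl]; norm_num
  have hbase : (d : ℝ) * (1 + d + (d + 1) * (4 * D)) / ρ ≤ 10 * f ^ 4 := by
    calc (d : ℝ) * (1 + d + (d + 1) * (4 * D)) / ρ
        = d * (1 + d + (d + 1) * (4 * D)) * (1 / ρ) := by ring
      _ ≤ f * (10 * f ^ 2) * f := by
          gcongr
          · linarith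
          · exact hM'.trans (by gcongr)
      _ = _ := by ring
  have hpos : 0 < (d : ℝ) * (1 + d + (d + 1) * (4 * D)) / ρ := by positivity
  have hlarge : ∀ c : ℝ, 0 < c → c ≤ 10 ^ 9 →
      Real.log (c * (d * (1 + d + (d + 1) * (4 * D)) / ρ)) ≤ 5 * l := by
    intro c hc hc'
    rw [hlog5]
    refine Real.log_le_log (by positivity) ?_
    calc c * (d * (1 + d + (d + 1) * (4 * D)) / ρ) ≤ 10 ^ 9 * (10 * f ^ 4) := by gcongr
      _ = 10 ^ 10 * f ^ 4 := by ring
      _ ≤ f * f ^ 4 := by gcongr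
      _ = _ := by ring
  have hclip : ρ ≤ 200 → (gaussianStdSamples d n).real
      {Z | ¬ ∀ U : EuclideanSpace ℝ (Fin d) ≃ₗᵢ[ℝ] EuclideanSpace ℝ (Fin d),
        ClipTest (ρ / 10 ^ 4) fun i => U (Z i)} ≤ β / 2 := by
    intro hρ2
    have h := measureReal_not_clipTest_le (d := d) (M := 4 * D) (ε := ρ / 10 ^ 4) hn0 hd0
      (by positivity) (by linarith) (by linarith)
    have h2 := pow_mul_two_mul_exp_le (d + d * d + 1) (t := n * (ρ / 10 ^ 4) ^ 2 / 2312)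
      (by positivity) hβ (hlarge (64 * 10 ^ 4) (by norm_num) (by norm_num)) (by
        rw [← hL]
        refine hNl.trans ?_
        have : n * (ρ / 10 ^ 4) ^ 2 / 2312 = n * ρ ^ 2 / (2312 * 10 ^ 8) := by ring
        rw [this, le_div_iff₀ (by norm_num)]
        refine le_trans ?_ hnρ
        have : 0 ≤ D ^ 2 * l := by positivity
        linarith)
    have e : 64 * d * (1 + d + (d + 1) * (4 * D)) / (ρ / 10 ^ 4)
        = 64 * 10 ^ 4 * (d * (1 + d + (d + 1) * (4 * D)) / ρ) := by field_simp
    rw [e] at h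
    linarith
  have hcount : 200 < ρ → (gaussianStdSamples d n).real
      {Z | ¬ ∀ U : EuclideanSpace ℝ (Fin d) ≃ₗᵢ[ℝ] EuclideanSpace ℝ (Fin d),
        CountTest ρ fun i => U (Z i)} ≤ β / 2 := by
    intro hρ2
    have h := measureReal_not_countTest_le (d := d) (M := 4 * D) (ρ := ρ) hn0 hd0
      (by linarith) (hρd.trans (Real.sqrt_le_self_iff.2 (Or.inr hd))) (by linarith)
    set t := -(n * (1 - (ρ ^ 2 / 1024 - 2) / 8)) with ht
    have h2 := pow_mul_two_mul_exp_le (d + d * d + 1) (t := t)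
      (by positivity) hβ (hlarge 256 (by norm_num) (by norm_num)) (by
        rw [← hL]
        refine hNl.trans ?_
        have h5 : (n : ℝ) * 40000 ≤ n * ρ ^ 2 := by
          gcongr
          calc (40000 : ℝ) = 200 ^ 2 := by norm_num
            _ ≤ ρ ^ 2 := pow_le_pow_left₀ (by norm_num) hρ2.le 2
        -- The additive losses amount to `5n/4`, and they are absorbed because `ρ² ≥ 40000`.
        have h6 : n * ρ ^ 2 / 16384 ≤ t := by
          rw [ht]; linarith
        refine le_trans ?_ h6
        rw [le_div_iff₀ (by norm_num)]
        have : 0 ≤ D ^ 2 * l := by positivity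
        linarith)
    have e : 256 * d * (1 + d + (d + 1) * (4 * D)) / ρ
        = 256 * (d * (1 + d + (d + 1) * (4 * D)) / ρ) := by ring
    have e2 : n * (1 - (ρ ^ 2 / 1024 - 2) / 8) = -t := by rw [ht]; ring
    rw [e, e2] at h
    have h7 : 0 ≤ (256 * (d * (1 + d + (d + 1) * (4 * D)) / ρ)) ^ (d + d * d + 1)
        * Real.exp (-t) := by positivity
    linarith
  rcases le_or_gt ρ 200 with hcase | hcase
  · have hsub : {Z : Dataset d n | ¬ LooksGaussian γ ρ Z} ⊆ {Z | ¬ CosTest γ Z} ∪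
        {Z | ¬ ∀ U : EuclideanSpace ℝ (Fin d) ≃ₗᵢ[ℝ] EuclideanSpace ℝ (Fin d),
          ClipTest (ρ / 10 ^ 4) fun i => U (Z i)} := by
      intro Z hZ
      simp only [Set.mem_ofPred_eq, Set.mem_union] at hZ ⊢
      by_contra hcon
      push Not at hcon
      exact hZ ⟨hcon.1, fun _ => hcon.2, fun h => absurd hcase (not_le.2 h)⟩
    have := (measureReal_mono (μ := gaussianStdSamples d n) hsub).trans (measureReal_union_le _ _)
    linarith [hclip hcase]
  · have hsub : {Z : Dataset d n | ¬ LooksGaussian γ ρ Z} ⊆ {Z | ¬ CosTest γ Z} ∪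
        {Z | ¬ ∀ U : EuclideanSpace ℝ (Fin d) ≃ₗᵢ[ℝ] EuclideanSpace ℝ (Fin d),
          CountTest ρ fun i => U (Z i)} := by
      intro Z hZ
      simp only [Set.mem_ofPred_eq, Set.mem_union] at hZ ⊢
      by_contra hcon
      push Not at hcon
      exact hZ ⟨hcon.1, fun h => absurd h (not_le.2 hcase), fun _ => hcon.2⟩
    have := (measureReal_mono (μ := gaussianStdSamples d n) hsub).trans (measureReal_union_le _ _)
    linarith [hcount hcase]

end

/-! ### Two models for the same data: scales and means -/

noncomputable section

variable {d n : ℕ}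

/-- The unit ball of frequencies is rotation invariant, which is why `LooksGaussian` quantifies over
isometries only in the other two tests. -/
lemma CosTest.comp_isometry {γ : ℝ} {Z : Dataset d n} (h : CosTest γ Z)
    (U : EuclideanSpace ℝ (Fin d) ≃ₗᵢ[ℝ] EuclideanSpace ℝ (Fin d)) :
    CosTest γ fun i => U (Z i) := by
  intro b hb c
  have h1 := h (U.symm b) (by simpa using hb) c
  have h2 : ∀ z, inner ℝ (U.symm b) z = inner ℝ b (U z) := by
    intro z
    rw [← U.inner_map_map (U.symm b) z, U.apply_symm_apply]
  simpa [h2] using h1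

/-- Empirical means of bounded quantities agreeing on all but `2 η n` of the data. -/
lemma abs_mean_sub_mean_le (hn : 0 < n) {g h : Fin n → ℝ} {B η : ℝ}
    (hg : ∀ i, |g i| ≤ B) (hh : ∀ i, |h i| ≤ B) {I : Finset (Fin n)}
    (hI : (I.card : ℝ) ≤ 2 * η * n) (heq : ∀ i ∉ I, g i = h i) :
    |(∑ i, g i) / n - (∑ i, h i) / n| ≤ 4 * B * η := by
  have hn' : (0 : ℝ) < n := by exact_mod_cast hn
  have hB : 0 ≤ B := (abs_nonneg _).trans (hg ⟨0, hn⟩)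
  rw [← sub_div, ← Finset.sum_sub_distrib, abs_div, abs_of_pos hn', div_le_iff₀ hn']
  have h1 : ∑ i, (g i - h i) = ∑ i ∈ I, (g i - h i) := by
    symm
    refine Finset.sum_subset (Finset.subset_univ _) fun i _ hi => ?_
    rw [heq i hi, sub_self]
  rw [h1]
  calc _ ≤ ∑ i ∈ I, |g i - h i| := Finset.abs_sum_le_sum_abs _ _
    _ ≤ ∑ _i ∈ I, 2 * B := Finset.sum_le_sum fun i _ => by
        have := abs_sub (g i) (h i)
        linarith [hg i, hh i]
    _ = I.card * (2 * B) := by rw [Finset.sum_const, nsmul_eq_mul]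
    _ ≤ 2 * η * n * (2 * B) := by gcongr
    _ = _ := by ring

/-- Coordinatewise scaling of a vector. -/
def scaleVec (s : Fin d → ℝ) (w : EuclideanSpace ℝ (Fin d)) : EuclideanSpace ℝ (Fin d) :=
  WithLp.toLp 2 fun j => s j * w j

lemma norm_scaleVec_sq (s : Fin d → ℝ) (w : EuclideanSpace ℝ (Fin d)) :
    ‖scaleVec s w‖ ^ 2 = ∑ j, s j ^ 2 * w j ^ 2 := by
  rw [EuclideanSpace.real_norm_sq_eq]
  exact Finset.sum_congr rfl fun j _ => by simp [scaleVec, mul_pow]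

/-- The characteristic functions of the two Gaussian models fitting nearly the same data agree. -/
lemma abs_exp_mul_cos_sub_le (hn : 0 < n) {γ η : ℝ} (hη : η ≤ γ) {Z W : Dataset d n}
    (hZ : CosTest γ Z) (hW : CosTest γ W) {m : EuclideanSpace ℝ (Fin d)} {s : Fin d → ℝ}
    {I : Finset (Fin n)} (hI : (I.card : ℝ) ≤ 2 * η * n)
    (heq : ∀ i ∉ I, Z i = m + scaleVec s (W i)) {w : EuclideanSpace ℝ (Fin d)}
    (hw : ‖w‖ ≤ 1) (hsw : ‖scaleVec s w‖ ≤ 1) (c : ℝ) :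
    |Real.exp (-‖w‖ ^ 2 / 2) * Real.cos c -
      Real.exp (-‖scaleVec s w‖ ^ 2 / 2) * Real.cos (inner ℝ w m + c)| ≤ 6 * γ := by
  have h1 := hZ w hw c
  have h2 := hW (scaleVec s w) hsw (inner ℝ w m + c)
  -- The total `6γ` is `γ + γ` from the two tests and `4η ≤ 4γ` from the points in `I`.
  have h3 := abs_mean_sub_mean_le hn (g := fun i => Real.cos (inner ℝ w (Z i) + c))
    (h := fun i => Real.cos (inner ℝ (scaleVec s w) (W i) + (inner ℝ w m + c))) (B := 1)
    (fun i => Real.abs_cos_le_one _) (fun i => Real.abs_cos_le_one _) hI (by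
      intro i hi
      congr 1
      have : inner ℝ w (scaleVec s (W i)) = inner ℝ (scaleVec s w) (W i) := by
        simp only [PiLp.inner_apply, scaleVec]
        exact Finset.sum_congr rfl fun j _ => by simp; ring
      rw [heq i hi, inner_add_right, this]
      ring)
  rw [abs_le] at *
  constructor <;> linarith [h1.1, h1.2, h2.1, h2.2, h3.1, h3.2]

lemma half_le_exp_neg_half : (1 / 2 : ℝ) ≤ Real.exp (-1 / 2) := by
  have := Real.add_one_le_exp (-1 / 2 : ℝ)
  linarith

/-- Factor out `exp (-1/2) ≥ 1/2` and use `exp y ≥ 1 + y` at `y = (1 - x)/2`. -/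
lemma one_sub_le_of_exp_sub_exp_le {x E : ℝ} (hx : x ≤ 1)
    (h : Real.exp (-x / 2) ≤ Real.exp (-1 / 2) + E) : 1 - x ≤ 4 * E := by
  have h1 : Real.exp (-x / 2) = Real.exp (-1 / 2) * Real.exp ((1 - x) / 2) := by
    rw [← Real.exp_add]; congr 1; ring
  have h2 := Real.add_one_le_exp ((1 - x) / 2)
  have h3 := mul_le_mul_of_nonneg_left h2 (Real.exp_pos (-1 / 2)).le
  have h4 := mul_le_mul_of_nonneg_right half_le_exp_neg_half (by linarith : 0 ≤ (1 - x) / 2)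
  linarith

/-- The scales of the two models agree. -/
lemma abs_sq_sub_one_le (hn : 0 < n) {γ η : ℝ} (hη : η ≤ γ) (hγ : γ ≤ 1 / 10 ^ 5)
    {Z W : Dataset d n}
    (hZ : CosTest γ Z) (hW : CosTest γ W) {m : EuclideanSpace ℝ (Fin d)} {s : Fin d → ℝ}
    (hs : ∀ j, 0 < s j) {I : Finset (Fin n)} (hI : (I.card : ℝ) ≤ 2 * η * n)
    (heq : ∀ i ∉ I, Z i = m + scaleVec s (W i)) (j : Fin d) : |s j ^ 2 - 1| ≤ 48 * γ := by
  have key : ∀ t : ℝ, 0 ≤ t → t ≤ 1 → s j * t ≤ 1 →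
      Real.exp (-t ^ 2 / 2) ≤ Real.exp (-(s j * t) ^ 2 / 2) + 6 * γ ∧
      Real.exp (-(s j * t) ^ 2 / 2) ≤ Real.exp (-t ^ 2 / 2) + 6 * γ := by
    intro t ht ht1 hst
    set w : EuclideanSpace ℝ (Fin d) := EuclideanSpace.single j t with hwdef
    have hw : ‖w‖ = t := by simp [hwdef, abs_of_nonneg ht]
    have hswe : scaleVec s w = EuclideanSpace.single j (s j * t) := by
      ext k
      by_cases hk : k = j
      · subst hk; simp [scaleVec, hwdef]
      · simp [scaleVec, hwdef, hk]
    have hsw : ‖scaleVec s w‖ = s j * t := by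
      rw [hswe, PiLp.norm_single, Real.norm_eq_abs,
        abs_of_nonneg (mul_nonneg (hs j).le ht)]
    -- The unknown mean enters only through a phase. Phase `0` puts the cosine on the second model
    -- and phase `-⟨w, m⟩` puts it on the first; bounding it by `1` gives the two one-sided
    -- comparisons.
    have h1 := abs_exp_mul_cos_sub_le hn hη hZ hW hI heq (w := w) (by rw [hw]; exact ht1)
      (by rw [hsw]; exact hst) 0
    have h2 := abs_exp_mul_cos_sub_le hn hη hZ hW hI heq (w := w) (by rw [hw]; exact ht1)
      (by rw [hsw]; exact hst) (-inner ℝ w m)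
    rw [hw, hsw] at h1 h2
    simp only [Real.cos_zero, mul_one, add_zero, add_neg_cancel] at h1 h2
    have h3 := mul_le_mul_of_nonneg_left (Real.cos_le_one (inner ℝ w m))
      (Real.exp_pos (-(s j * t) ^ 2 / 2)).le
    have h4 := mul_le_mul_of_nonneg_left (Real.cos_le_one (-inner ℝ w m))
      (Real.exp_pos (-t ^ 2 / 2)).le
    rw [abs_le] at h1 h2
    constructor <;> linarith [h1.1, h1.2, h2.1, h2.2]
  rcases le_total 1 (s j) with h | h
  -- The frequency is as large as both models allow: `t = 1/s` for `s ≥ 1` and `t = 1` otherwise, so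
  -- one of the exponents is `-1/2`.
  · have h1 := (key (s j)⁻¹ (by have := hs j; positivity) (inv_le_one_of_one_le₀ h)
      (by rw [mul_inv_cancel₀ (hs j).ne'])).1
    rw [mul_inv_cancel₀ (hs j).ne', one_pow, inv_pow] at h1
    have hs2 : 1 ≤ s j ^ 2 := one_le_pow₀ h
    have h2 := one_sub_le_of_exp_sub_exp_le (inv_le_one_of_one_le₀ hs2) h1
    have h3 : s j ^ 2 * (s j ^ 2)⁻¹ = 1 := mul_inv_cancel₀ (by positivity)
    have h4 : s j ^ 2 * (1 / 2) ≤ s j ^ 2 * (s j ^ 2)⁻¹ := by gcongr; linarith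
    have h5 : s j ^ 2 * (1 - (s j ^ 2)⁻¹) ≤ 2 * (4 * (6 * γ)) :=
      mul_le_mul (by linarith) h2 (sub_nonneg.2 (inv_le_one_of_one_le₀ hs2)) (by norm_num)
    rw [abs_of_nonneg (by linarith)]
    linarith
  · have h1 := (key 1 zero_le_one le_rfl (by linarith)).2
    rw [mul_one, one_pow] at h1
    have hs2 : s j ^ 2 ≤ 1 := pow_le_one₀ (hs j).le h
    have h2 := one_sub_le_of_exp_sub_exp_le hs2 h1
    rw [abs_sub_comm, abs_of_nonneg (by linarith)]
    linarith

/-- The means of the two models agree. -/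
lemma norm_mean_le (hn : 0 < n) {γ η : ℝ} (hη : η ≤ γ) (hγ0 : 0 < γ) (hγ : γ ≤ 1 / 10 ^ 5)
    {Z W : Dataset d n}
    (hZ : CosTest γ Z) (hW : CosTest γ W) {m : EuclideanSpace ℝ (Fin d)} {s : Fin d → ℝ}
    (hs : ∀ j, |s j ^ 2 - 1| ≤ 48 * γ) {I : Finset (Fin n)} (hI : (I.card : ℝ) ≤ 2 * η * n)
    (heq : ∀ i ∉ I, Z i = m + scaleVec s (W i)) : ‖m‖ ≤ 48 * γ := by
  by_cases hm0 : m = 0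
  · rw [hm0, norm_zero]; positivity
  have hm : 0 < ‖m‖ := norm_pos_iff.2 hm0
  -- The bound `t ≤ 1/2` keeps the rescaled frequency in the unit ball, and `t‖m‖ ≤ 1` keeps the
  -- angle where the sine is at least half its argument.
  set t := min (1 / 2) ‖m‖⁻¹ with ht
  have ht0 : 0 < t := lt_min (by norm_num) (by positivity)
  have ht2 : t ≤ 1 / 2 := min_le_left _ _
  set w : EuclideanSpace ℝ (Fin d) := (t * ‖m‖⁻¹) • m with hwdef
  have hw : ‖w‖ = t := by
    rw [hwdef, norm_smul, Real.norm_eq_abs, abs_of_pos (by positivity)]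
    field_simp
  have hsw : ‖scaleVec s w‖ ≤ 1 := by
    refine (sq_le_one_iff₀ (norm_nonneg _)).1 ?_
    rw [norm_scaleVec_sq]
    calc ∑ j, s j ^ 2 * w j ^ 2 ≤ ∑ j, 4 * w j ^ 2 := Finset.sum_le_sum fun j _ => by
          gcongr
          linarith [(abs_le.1 (hs j)).2]
      _ = 4 * t ^ 2 := by rw [← Finset.mul_sum, ← EuclideanSpace.real_norm_sq_eq, hw]
      _ ≤ 4 * (1 / 2) ^ 2 := by gcongr
      _ = 1 := by norm_num
  have hin : inner ℝ w m = t * ‖m‖ := by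
    rw [hwdef, real_inner_smul_left, real_inner_self_eq_norm_sq]
    field_simp
  -- The phase `-π/2` annihilates the first model's term and turns the second's into `sin (t‖m‖)`.
  have h1 := abs_exp_mul_cos_sub_le hn hη hZ hW hI heq (w := w) (by rw [hw]; linarith) hsw
    (-(Real.pi / 2))
  rw [Real.cos_neg, Real.cos_pi_div_two, ← sub_eq_add_neg, Real.cos_sub_pi_div_two, hin,
    mul_zero, zero_sub, abs_neg] at h1
  have hθ0 : 0 < t * ‖m‖ := by positivity
  have hθ1 : t * ‖m‖ ≤ 1 := by
    calc t * ‖m‖ ≤ ‖m‖⁻¹ * ‖m‖ := by gcongr; exact min_le_right _ _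
      _ = 1 := inv_mul_cancel₀ hm.ne'
  have h2 := Real.mul_le_sin hθ0.le (by linarith [Real.pi_gt_three])
  have h3 : 1 / 2 * (t * ‖m‖) ≤ 2 / Real.pi * (t * ‖m‖) := by
    refine mul_le_mul_of_nonneg_right ?_ hθ0.le
    rw [div_le_div_iff₀ (by norm_num) Real.pi_pos]
    linarith [Real.pi_le_four]
  have h4 : 1 / 2 ≤ Real.exp (-‖scaleVec s w‖ ^ 2 / 2) := by
    refine half_le_exp_neg_half.trans (Real.exp_le_exp.2 ?_)
    have := pow_le_one₀ (norm_nonneg (scaleVec s w)) hsw (n := 2)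
    linarith
  have h5 : 1 / 2 * (1 / 2 * (t * ‖m‖)) ≤
      Real.exp (-‖scaleVec s w‖ ^ 2 / 2) * Real.sin (t * ‖m‖) :=
    mul_le_mul h4 (by linarith) (by positivity) (Real.exp_pos _).le
  have h6 : t * ‖m‖ ≤ 24 * γ := by
    have := le_abs_self (Real.exp (-‖scaleVec s w‖ ^ 2 / 2) * Real.sin (t * ‖m‖))
    linarith
  rcases min_choice (1 / 2) ‖m‖⁻¹ with h7 | h7
  · rw [← ht] at h7
    rw [h7] at h6
    linarith
  -- Here `t‖m‖ = 1`, which contradicts `t‖m‖ ≤ 24γ`.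
  · rw [← ht] at h7
    rw [h7, inv_mul_cancel₀ hm.ne'] at h6
    linarith

end

/-! ### Two models for the same data: Frobenius distance -/

noncomputable section

variable {d n : ℕ}

lemma clip_mono : Monotone clip := fun _ _ h => max_le_max le_rfl (min_le_min le_rfl h)

/-- Truncation keeps upward shifts of moderate numbers. -/
lemma min_le_clip_add_sub_clip {x D v : ℝ} (hx : |x| < 16) (hD : v ≤ D) (hv : v ≤ 1) (hv0 : 0 ≤ v) :
    v ≤ clip (x + D) - clip x := by
  have hx' := abs_lt.1 hx
  have h1 : clip (x + v) ≤ clip (x + D) := clip_mono (by linarith)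
  -- The truncation level `17` is `16 + 1`: values below `16` in modulus, shifted by at most `1`,
  -- remain untruncated.
  have h2 : clip (x + v) = x + v := by
    unfold clip; rw [min_eq_right (by linarith), max_eq_right (by linarith)]
  have h3 : clip x = x := by
    unfold clip; rw [min_eq_right (by linarith), max_eq_right (by linarith)]
  linarith

/-- A quadratic polynomial of an affinely transformed vector. -/
lemma diagQuad_add_scaleVec (a s : Fin d → ℝ) (m w : EuclideanSpace ℝ (Fin d)) :
    diagQuad a 0 (-∑ j, a j) (m + scaleVec s w)
      = diagQuad (fun j => a j * s j ^ 2) (fun j => 2 * a j * m j * s j)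
          (∑ j, a j * m j ^ 2 - ∑ j, a j) w := by
  have : ∀ j, a j * (m + scaleVec s w) j ^ 2
      = a j * s j ^ 2 * w j ^ 2 + 2 * a j * m j * s j * w j + a j * m j ^ 2 := by
    intro j
    simp only [scaleVec, PiLp.add_apply]
    ring
  unfold diagQuad
  simp only [this, Finset.sum_add_distrib, Pi.zero_apply, zero_mul, Finset.sum_const_zero]
  ring

lemma sum_sq_linear_coeff_le {a s : Fin d → ℝ} {m : EuclideanSpace ℝ (Fin d)} {κ : ℝ}
    (ha : ∀ j, |a j| ≤ 1) (hs : ∀ j, s j ^ 2 ≤ 2) (hm : ‖m‖ ≤ κ) :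
    ∑ j, (2 * a j * m j * s j) ^ 2 ≤ 8 * κ ^ 2 := by
  calc ∑ j, (2 * a j * m j * s j) ^ 2 ≤ ∑ j, 8 * m j ^ 2 := Finset.sum_le_sum fun j _ => by
        have h1 : a j ^ 2 ≤ 1 := (sq_le_one_iff_abs_le_one _).2 (ha j)
        have h2 : a j ^ 2 * s j ^ 2 ≤ 1 * 2 := mul_le_mul h1 (hs j) (sq_nonneg _) zero_le_one
        have h3 := mul_le_mul_of_nonneg_right h2 (sq_nonneg (m j))
        calc (2 * a j * m j * s j) ^ 2 = 4 * (a j ^ 2 * s j ^ 2 * m j ^ 2) := by ring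
          _ ≤ _ := by linarith
    _ = 8 * ‖m‖ ^ 2 := by rw [← Finset.mul_sum, ← EuclideanSpace.real_norm_sq_eq]
    _ ≤ _ := by gcongr

lemma abs_sum_mul_sq_le {a : Fin d → ℝ} {m : EuclideanSpace ℝ (Fin d)} {κ : ℝ}
    (ha : ∀ j, |a j| ≤ 1) (hm : ‖m‖ ≤ κ) : |∑ j, a j * m j ^ 2| ≤ κ ^ 2 := by
  calc |∑ j, a j * m j ^ 2| ≤ ∑ j, |a j * m j ^ 2| := Finset.abs_sum_le_sum_abs _ _
    _ ≤ ∑ j, m j ^ 2 := Finset.sum_le_sum fun j _ => by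
        rw [abs_mul, abs_of_nonneg (sq_nonneg (m j))]
        exact mul_le_of_le_one_left (sq_nonneg _) (ha j)
    _ = ‖m‖ ^ 2 := by rw [← EuclideanSpace.real_norm_sq_eq]
    _ ≤ _ := by gcongr

/-- Integrate `|x| ≤ x²/(2κ) + κ/2`; the second moment of the linear form is `∑ b j²`. -/
lemma integral_abs_linear_le (b : Fin d → ℝ) {κ : ℝ} (hκ : 0 < κ) (hb : ∑ j, b j ^ 2 ≤ 8 * κ ^ 2) :
    Integrable (fun z : EuclideanSpace ℝ (Fin d) => |∑ j, b j * z j|) (gaussianStd d) ∧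
      ∫ z, |∑ j, b j * z j| ∂(gaussianStd d) ≤ 5 * κ := by
  set b' : EuclideanSpace ℝ (Fin d) := WithLp.toLp 2 b with hb'
  have hin : ∀ z : EuclideanSpace ℝ (Fin d), ∑ j, b j * z j = inner ℝ b' z := by
    intro z
    simp only [PiLp.inner_apply, hb']
    exact Finset.sum_congr rfl fun j _ => by simp [mul_comm]
  have hnorm : ‖b'‖ ^ 2 = ∑ j, b j ^ 2 := by rw [EuclideanSpace.real_norm_sq_eq]
  obtain ⟨h1, h2⟩ := integral_inner_sq_stdGaussian b'
  have hi : Integrable (fun z => inner ℝ b' z ^ 2 / (2 * κ) + κ / 2) (gaussianStd d) :=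
    (h1.div_const _).add (integrable_const _)
  have hle : ∀ z, |inner ℝ b' z| ≤ inner ℝ b' z ^ 2 / (2 * κ) + κ / 2 := by
    intro z
    have : inner ℝ b' z ^ 2 / (2 * κ) + κ / 2 - |inner ℝ b' z|
        = (|inner ℝ b' z| - κ) ^ 2 / (2 * κ) := by
      rw [← sq_abs]; field_simp; ring
    have h3 : 0 ≤ (|inner ℝ b' z| - κ) ^ 2 / (2 * κ) := by positivity
    linarith
  simp_rw [hin]
  have hI : Integrable (fun z => |inner ℝ b' z|) (gaussianStd d) := by
    refine hi.mono' (Continuous.aestronglyMeasurable (by fun_prop))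
      (Filter.Eventually.of_forall fun z => ?_)
    rw [Real.norm_eq_abs, abs_abs]
    exact hle z
  refine ⟨hI, (integral_mono hI hi hle).trans ?_⟩
  rw [integral_add (h1.div_const _) (integrable_const _), integral_div, h2, hnorm]
  simp only [integral_const, probReal_univ, one_smul]
  have : (∑ j, b j ^ 2) / (2 * κ) ≤ 4 * κ := by
    rw [div_le_iff₀ (by positivity)]; linarith
  linarith

lemma integrable_clip_diagQuad (a b : Fin d → ℝ) (c : ℝ) :
    Integrable (fun z => clip (diagQuad a b c z)) (gaussianStd d) :=
  Integrable.of_bound (continuous_clip.comp (continuous_diagQuad a b c)).aestronglyMeasurable 17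
    (Filter.Eventually.of_forall fun z => by rw [Real.norm_eq_abs]; exact abs_clip_le _)

/-- The truncated quadratic polynomial adapted to the difference of two covariances has a larger
mean under the second Gaussian. -/
lemma le_integral_clip_sub_integral_clip {r κ v : ℝ} {a s : Fin d → ℝ}
    {m : EuclideanSpace ℝ (Fin d)} (hκ : 0 < κ) (hκ1 : κ ≤ 1) (hr : 40 * κ ≤ r)
    (hs : ∀ j, |s j ^ 2 - 1| ≤ κ) (hm : ‖m‖ ≤ κ) (has : ∀ j, r * a j = s j ^ 2 - 1)
    (ha2 : ∑ j, a j ^ 2 = 1) (hv0 : 0 ≤ v) (hv1 : v ≤ 1) (hvr : v ≤ r / 2) :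
    v / 2 - 6 * κ ≤
      ∫ z, clip (diagQuad (fun j => a j * s j ^ 2) (fun j => 2 * a j * m j * s j)
          (∑ j, a j * m j ^ 2 - ∑ j, a j) z) ∂(gaussianStd d)
        - ∫ z, clip (diagQuad a 0 (-∑ j, a j) z) ∂(gaussianStd d) := by
  have hr0 : 0 < r := by linarith
  have ha1 : ∀ j, |a j| ≤ 1 := by
    intro j
    rw [← sq_le_one_iff_abs_le_one, ← ha2]
    exact Finset.single_le_sum (f := fun j => a j ^ 2) (fun j _ => sq_nonneg _) (Finset.mem_univ j)
  -- The shift of the polynomial is `∑ e j z j²` up to linear and constant terms. As `e j = r a j² ≥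
  -- 0`, it is nonnegative everywhere with mean `r`, so by monotonicity of `clip` the exceptional
  -- set costs nothing.
  set e : Fin d → ℝ := fun j => a j * (s j ^ 2 - 1) with he
  have hesum : ∑ j, e j = r := by
    have : ∀ j, e j = r * a j ^ 2 := fun j => by rw [he]; simp only; rw [← has]; ring
    simp_rw [this, ← Finset.mul_sum, ha2, mul_one]
  have he1 : ∀ j, |e j| ≤ κ := fun j => by
    rw [he]; simp only [abs_mul]
    exact (mul_le_of_le_one_left (abs_nonneg _) (ha1 j)).trans (hs j)
  have he2 : ∑ j, e j ^ 2 ≤ κ ^ 2 := by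
    calc ∑ j, e j ^ 2 ≤ ∑ j, a j ^ 2 * κ ^ 2 := Finset.sum_le_sum fun j _ => by
          rw [he]; simp only [mul_pow]
          exact mul_le_mul_of_nonneg_left (sq_le_sq.2 ((hs j).trans (le_abs_self κ))) (sq_nonneg _)
      _ = _ := by rw [← Finset.sum_mul, ha2, one_mul]
  set b : Fin d → ℝ := fun j => 2 * a j * m j * s j with hb
  have hb2 : ∑ j, b j ^ 2 ≤ 8 * κ ^ 2 :=
    sum_sq_linear_coeff_le ha1 (fun j => by linarith [(abs_le.1 (hs j)).2]) hm
  have hmm := abs_sum_mul_sq_le ha1 hm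
  set B1 : Set (EuclideanSpace ℝ (Fin d)) := {z | 16 ≤ |∑ j, a j * (z j ^ 2 - 1)|} with hB1
  set B2 : Set (EuclideanSpace ℝ (Fin d)) := {z | r / 2 ≤ |∑ j, e j * (z j ^ 2 - 1)|} with hB2
  -- Outside `B1` the polynomial is below `16` in modulus, and outside `B2` the shift exceeds `r/2`.
  -- The exponents are `1/4 - 4` here and at most `1/4 - 5` for `B2`, by `r ≥ 40κ`; together the two
  -- events have probability at most `1/2`.
  have hP1 : (gaussianStd d).real B1 ≤ 2 * Real.exp (-3) := by
    have h := stdGaussian_abs_quadratic_tail_le (a := a) (l := 1 / 4) (t := 16) (by norm_num)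
      (fun j => by linarith [ha1 j])
    refine h.trans ?_
    gcongr
    rw [ha2]; norm_num
  have hP2 : (gaussianStd d).real B2 ≤ 2 * Real.exp (-3) := by
    have h := stdGaussian_abs_quadratic_tail_le (a := e) (l := 1 / (4 * κ)) (t := r / 2)
      (by positivity)
      (fun j => by
        rw [one_div_mul_eq_div, div_le_iff₀ (by positivity)]
        linarith [he1 j])
    refine h.trans ?_
    gcongr
    have h1 : 4 * (1 / (4 * κ)) ^ 2 * ∑ j, e j ^ 2 ≤ 4 * (1 / (4 * κ)) ^ 2 * κ ^ 2 := by gcongr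
    have h2 : 4 * (1 / (4 * κ)) ^ 2 * κ ^ 2 = 1 / 4 := by field_simp
    have h3 : 5 ≤ 1 / (4 * κ) * (r / 2) := by
      rw [one_div_mul_eq_div, le_div_iff₀ (by positivity)]; linarith
    linarith
  have hmeas : MeasurableSet (B1 ∪ B2) := by
    refine MeasurableSet.union ?_ ?_
    · exact measurableSet_le measurable_const (Continuous.measurable (by fun_prop))
    · exact measurableSet_le measurable_const (Continuous.measurable (by fun_prop))
  have hG : 1 / 2 ≤ (gaussianStd d).real (B1 ∪ B2)ᶜ := by
    rw [probReal_compl_eq_one_sub hmeas]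
    have := measureReal_union_le (μ := gaussianStd d) B1 B2
    linarith [exp_neg_three_le]
  obtain ⟨hI, hIle⟩ := integral_abs_linear_le b hκ hb2
  have hpt : ∀ z : EuclideanSpace ℝ (Fin d),
      (B1 ∪ B2)ᶜ.indicator (fun _ => v) z - |∑ j, b j * z j| - κ ^ 2 ≤
      clip (diagQuad (fun j => a j * s j ^ 2) b (∑ j, a j * m j ^ 2 - ∑ j, a j) z)
        - clip (diagQuad a 0 (-∑ j, a j) z) := by
    intro z
    set x := diagQuad a 0 (-∑ j, a j) z with hx
    have hx' : x = ∑ j, a j * (z j ^ 2 - 1) := by rw [hx, diagQuad_neg_sum]; simp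
    have hq : diagQuad (fun j => a j * s j ^ 2) b (∑ j, a j * m j ^ 2 - ∑ j, a j) z
        = x + ∑ j, e j * z j ^ 2 + (∑ j, b j * z j + ∑ j, a j * m j ^ 2) := by
      rw [hx]
      unfold diagQuad
      have : ∀ j, a j * s j ^ 2 * z j ^ 2 = a j * z j ^ 2 + e j * z j ^ 2 := fun j => by
        rw [he]; ring
      simp only [this, Finset.sum_add_distrib, Pi.zero_apply, zero_mul, Finset.sum_const_zero]
      ring
    have hD : ∑ j, e j * z j ^ 2 = r + ∑ j, e j * (z j ^ 2 - 1) := by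
      rw [← hesum, ← Finset.sum_add_distrib]
      exact Finset.sum_congr rfl fun j _ => by ring
    have hD0 : 0 ≤ ∑ j, e j * z j ^ 2 := Finset.sum_nonneg fun j _ => by
      refine mul_nonneg ?_ (sq_nonneg _)
      rw [he]; simp only; rw [← has]
      nlinarith [sq_nonneg (a j)]
    have h1 := abs_clip_sub_clip_le (x + ∑ j, e j * z j ^ 2 + (∑ j, b j * z j + ∑ j, a j * m j ^ 2))
      (x + ∑ j, e j * z j ^ 2)
    rw [add_sub_cancel_left] at h1
    have h2 := (abs_le.1 (h1.trans (abs_add_le _ _))).1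
    have h3 : (B1 ∪ B2)ᶜ.indicator (fun _ => v) z ≤ clip (x + ∑ j, e j * z j ^ 2) - clip x := by
      by_cases hz : z ∈ (B1 ∪ B2)ᶜ
      · rw [Set.indicator_of_mem hz]
        rw [Set.mem_compl_iff, Set.mem_union, not_or, hB1, hB2] at hz
        simp only [Set.mem_ofPred_eq, not_le] at hz
        refine min_le_clip_add_sub_clip (by rw [hx']; exact hz.1) ?_ hv1 hv0
        rw [hD]
        linarith [(abs_lt.1 hz.2).1]
      · rw [Set.indicator_of_notMem hz]
        have := clip_mono (le_add_of_nonneg_right hD0 : x ≤ x + ∑ j, e j * z j ^ 2)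
        linarith
    rw [hq]
    linarith
  have hind : Integrable ((B1 ∪ B2)ᶜ.indicator fun _ : EuclideanSpace ℝ (Fin d) => v)
      (gaussianStd d) := (integrable_const _).indicator hmeas.compl
  have hmono := integral_mono ((hind.sub hI).sub (integrable_const (κ ^ 2)))
    ((integrable_clip_diagQuad _ _ _).sub (integrable_clip_diagQuad _ _ _)) hpt
  rw [integral_sub' (integrable_clip_diagQuad _ _ _) (integrable_clip_diagQuad _ _ _)] at hmono
  refine le_trans ?_ hmono
  rw [integral_sub' (hind.sub hI) (integrable_const _), integral_sub' hind hI,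
    integral_indicator_const _ hmeas.compl]
  simp only [integral_const, probReal_univ, smul_eq_mul]
  have h1 : 1 / 2 * v ≤ (gaussianStd d).real (B1 ∪ B2)ᶜ * v := by gcongr
  have h2 : κ ^ 2 ≤ κ := by rw [sq]; exact mul_le_of_le_one_left hκ.le hκ1
  linarith

/-- The covariances of two Gaussian models fitting nearly the same data are close in Frobenius
norm, at small scales. -/
lemma sum_sq_le_of_clipTest (hn : 0 < n) {γ ρ η : ℝ} (hη : η ≤ γ) (hγ0 : 0 < γ)
    (hγ : γ ≤ 1 / 10 ^ 5) (hγρ : γ ≤ ρ) (hρ : ρ ≤ 200) {Z W : Dataset d n}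
    (hZ : ClipTest (ρ / 10 ^ 4) Z) (hW : ClipTest (ρ / 10 ^ 4) W)
    {m : EuclideanSpace ℝ (Fin d)} {s : Fin d → ℝ} (hs : ∀ j, |s j ^ 2 - 1| ≤ 48 * γ)
    (hm : ‖m‖ ≤ 48 * γ) {I : Finset (Fin n)} (hI : (I.card : ℝ) ≤ 2 * η * n)
    (heq : ∀ i ∉ I, Z i = m + scaleVec s (W i)) :
    √(∑ j, (s j ^ 2 - 1) ^ 2) ≤ 2000 * ρ := by
  by_contra hcon
  push Not at hcon
  set r := √(∑ j, (s j ^ 2 - 1) ^ 2) with hr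
  have hρ0 : 0 < ρ := by linarith
  have hr0 : 0 < r := by linarith
  have hrsq : r ^ 2 = ∑ j, (s j ^ 2 - 1) ^ 2 := Real.sq_sqrt (Finset.sum_nonneg fun j _ => sq_nonneg _)
  set a : Fin d → ℝ := fun j => (s j ^ 2 - 1) / r with ha
  have has : ∀ j, r * a j = s j ^ 2 - 1 := fun j => by rw [ha]; field_simp
  have ha2 : ∑ j, a j ^ 2 = 1 := by
    simp_rw [ha, div_pow, ← Finset.sum_div, ← hrsq]
    field_simp
  have ha1 : ∀ j, |a j| ≤ 1 := by
    intro j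
    rw [← sq_le_one_iff_abs_le_one, ← ha2]
    exact Finset.single_le_sum (f := fun j => a j ^ 2) (fun j _ => sq_nonneg _) (Finset.mem_univ j)
  have hd1 : (1 : ℝ) ≤ d := by
    have : 0 < d := by
      rcases Nat.eq_zero_or_pos d with h | h
      · subst h; simp at ha2
      · exact h
    exact_mod_cast this
  have hsuma : |∑ j, a j| ≤ d := by
    refine (Finset.abs_sum_le_sum_abs _ _).trans ((Finset.sum_le_sum fun j _ => ha1 j).trans ?_)
    simp
  have hs2 : ∀ j, s j ^ 2 ≤ 2 := fun j => by linarith [(abs_le.1 (hs j)).2]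
  have hmm := abs_sum_mul_sq_le ha1 hm
  have hb2 := sum_sq_linear_coeff_le ha1 hs2 hm
  have hκ2 : (48 * γ) ^ 2 ≤ 1 / 8 := by
    calc (48 * γ) ^ 2 ≤ (1 / 100) ^ 2 := by gcongr; linarith
      _ ≤ _ := by norm_num
  have h1 := hZ a 0 (-∑ j, a j) (fun j => (ha1 j).trans one_le_two) (fun j => by simp)
    (by rw [abs_neg]; linarith)
  have h2 := hW (fun j => a j * s j ^ 2) (fun j => 2 * a j * m j * s j)
    (∑ j, a j * m j ^ 2 - ∑ j, a j)
    (fun j => by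
      rw [abs_mul, abs_of_nonneg (sq_nonneg (s j))]
      exact (mul_le_of_le_one_left (sq_nonneg _) (ha1 j)).trans (hs2 j))
    (fun j => by
      have : (2 * a j * m j * s j) ^ 2 ≤ 1 :=
        (Finset.single_le_sum (f := fun j => (2 * a j * m j * s j) ^ 2) (fun j _ => sq_nonneg _)
          (Finset.mem_univ j)).trans (by linarith)
      exact ((sq_le_one_iff_abs_le_one _).1 this).trans one_le_two)
    (by
      have := abs_sub (∑ j, a j * m j ^ 2) (∑ j, a j)
      linarith)
  have h3 := abs_mean_sub_mean_le hn (g := fun i => clip (diagQuad a 0 (-∑ j, a j) (Z i)))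
    (h := fun i => clip (diagQuad (fun j => a j * s j ^ 2) (fun j => 2 * a j * m j * s j)
      (∑ j, a j * m j ^ 2 - ∑ j, a j) (W i))) (B := 17)
    (fun i => abs_clip_le _) (fun i => abs_clip_le _) hI (fun i hi => by
      simp only
      rw [heq i hi, diagQuad_add_scaleVec])
  -- The condition `r ≥ 40·48γ = 1920γ` follows from `r > 2000ρ` and `γ ≤ ρ`.
  have h4 := le_integral_clip_sub_integral_clip (v := min (r / 2) 1) (by positivity : 0 < 48 * γ)
    (by linarith) (by linarith) hs hm has ha2 (le_min (by linarith) zero_le_one)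
    (min_le_right _ _) (min_le_left _ _)
  rw [abs_le] at h1 h2 h3
  have h5 : min (r / 2) 1 / 2 - 6 * (48 * γ) ≤ 2 * (ρ / 10 ^ 4) + 68 * γ := by
    linarith [h1.1, h1.2, h2.1, h2.2, h3.1, h3.2]
  -- If the minimum is `r/2`, then `r/4 > 500ρ` beats all errors since `γ ≤ ρ`. If it is `1`, then
  -- `1/2` beats them because `ρ ≤ 200` and `γ ≤ 10⁻⁵`.
  rcases min_choice (r / 2) 1 with h6 | h6 <;> rw [h6] at h5 <;> linarith

/-- The covariances of two Gaussian models fitting nearly the same data are close in Frobenius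
norm, at large scales. -/
lemma sum_sq_le_of_countTest (hn : 0 < n) {γ ρ η : ℝ} (hη : η ≤ γ) (hγ0 : 0 < γ)
    (hγ : γ ≤ 1 / 10 ^ 5) (hρ : 1 ≤ ρ) {Z W : Dataset d n}
    (hZ : CountTest ρ Z) (hW : CountTest ρ W)
    {m : EuclideanSpace ℝ (Fin d)} {s : Fin d → ℝ} (hs : ∀ j, |s j ^ 2 - 1| ≤ 48 * γ)
    (hm : ‖m‖ ≤ 48 * γ) {I : Finset (Fin n)} (hI : (I.card : ℝ) ≤ 2 * η * n)
    (heq : ∀ i ∉ I, Z i = m + scaleVec s (W i)) :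
    √(∑ j, (s j ^ 2 - 1) ^ 2) ≤ 2000 * ρ := by
  by_contra hcon
  push Not at hcon
  set r := √(∑ j, (s j ^ 2 - 1) ^ 2) with hr
  have hρ0 : 0 < ρ := by linarith
  have hn' : (0 : ℝ) < n := by exact_mod_cast hn
  have hr0 : 0 < r := by linarith
  have hrsq : r ^ 2 = ∑ j, (s j ^ 2 - 1) ^ 2 := Real.sq_sqrt (Finset.sum_nonneg fun j _ => sq_nonneg _)
  set a : Fin d → ℝ := fun j => (s j ^ 2 - 1) / r with ha
  have has : ∀ j, r * a j = s j ^ 2 - 1 := fun j => by rw [ha]; field_simp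
  have ha2 : ∑ j, a j ^ 2 = 1 := by
    simp_rw [ha, div_pow, ← Finset.sum_div, ← hrsq]
    field_simp
  have ha1 : ∀ j, |a j| ≤ 1 := by
    intro j
    rw [← sq_le_one_iff_abs_le_one, ← ha2]
    exact Finset.single_le_sum (f := fun j => a j ^ 2) (fun j _ => sq_nonneg _) (Finset.mem_univ j)
  have haρ : ∀ j, |a j| ≤ 1 / 2 * (1 / ρ) := by
    intro j
    rw [ha]
    simp only [abs_div, abs_of_pos hr0]
    rw [one_div_mul_one_div, div_le_div_iff₀ hr0 (by positivity)]
    have h1 : |s j ^ 2 - 1| ≤ 1 := by linarith [hs j]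
    have h2 := mul_le_mul_of_nonneg_right h1 (by positivity : 0 ≤ 2 * ρ)
    linarith
  have hs2 : ∀ j, s j ^ 2 ≤ 2 := fun j => by linarith [(abs_le.1 (hs j)).2]
  have hmm := abs_sum_mul_sq_le ha1 hm
  have hb2 := sum_sq_linear_coeff_le ha1 hs2 hm
  have hκ2 : (48 * γ) ^ 2 ≤ 1 / 8 := by
    calc (48 * γ) ^ 2 ≤ (1 / 100) ^ 2 := by gcongr; linarith
      _ ≤ _ := by norm_num
  have hγρ : 0 < 1 / ρ := by positivity
  have h1 := hZ a 0 (by rw [ha2]; norm_num) (fun j => (haρ j).trans (by linarith)) (by simp)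
  have h2 := hW (fun j => a j * s j ^ 2) (fun j => 2 * a j * m j * s j)
    (by
      calc ∑ j, (a j * s j ^ 2) ^ 2 ≤ ∑ j, a j ^ 2 * 2 ^ 2 := Finset.sum_le_sum fun j _ => by
            rw [mul_pow]
            gcongr
            exact hs2 j
        _ = 4 := by rw [← Finset.sum_mul, ha2]; norm_num)
    (fun j => by
      rw [abs_mul, abs_of_nonneg (sq_nonneg (s j))]
      calc |a j| * s j ^ 2 ≤ 1 / 2 * (1 / ρ) * 2 :=
            mul_le_mul (haρ j) (hs2 j) (sq_nonneg _) (by positivity)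
        _ = _ := by ring)
    (by linarith)
  set J1 := Finset.univ.filter fun i => ρ < |diagQuad a 0 (-∑ j, a j) (Z i)|
  set J2 := Finset.univ.filter fun i => ρ < |diagQuad (fun j => a j * s j ^ 2)
    (fun j => 2 * a j * m j * s j) (-∑ j, a j * s j ^ 2) (W i)|
  -- At most `n/4 + n/4 + 2ηn < n` indices are bad. At a good one both polynomials are at most `ρ`
  -- in modulus while they differ by nearly `r`.
  obtain ⟨i, hi⟩ : ∃ i, i ∉ J1 ∪ J2 ∪ I := by
    by_contra hall
    push Not at hall
    have huniv : J1 ∪ J2 ∪ I = Finset.univ := Finset.eq_univ_iff_forall.2 hall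
    have hc : (n : ℝ) ≤ J1.card + J2.card + I.card := by
      have : n ≤ J1.card + J2.card + I.card := by
        calc n = (J1 ∪ J2 ∪ I).card := by rw [huniv]; simp
          _ ≤ _ := (Finset.card_union_le _ _).trans
              (Nat.add_le_add_right (Finset.card_union_le _ _) _)
      exact_mod_cast this
    have : 2 * η * n ≤ 2 * (1 / 10 ^ 5) * n := by gcongr; linarith
    linarith
  simp only [Finset.mem_union, not_or] at hi
  obtain ⟨⟨hi1, hi2⟩, hi3⟩ := hi
  simp only [J1, J2, Finset.mem_filter, Finset.mem_univ, true_and, not_lt] at hi1 hi2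
  rw [heq i hi3, diagQuad_add_scaleVec] at hi1
  have hshift : diagQuad (fun j => a j * s j ^ 2) (fun j => 2 * a j * m j * s j)
      (∑ j, a j * m j ^ 2 - ∑ j, a j) (W i)
      = diagQuad (fun j => a j * s j ^ 2) (fun j => 2 * a j * m j * s j)
      (-∑ j, a j * s j ^ 2) (W i) + r + ∑ j, a j * m j ^ 2 := by
    have : ∑ j, a j * s j ^ 2 = r + ∑ j, a j := by
      have h3 : ∀ j, a j * s j ^ 2 = r * a j ^ 2 + a j := fun j => by
        have := has j
        have h4 : s j ^ 2 = r * a j + 1 := by linarith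
        rw [h4]; ring
      simp_rw [h3, Finset.sum_add_distrib, ← Finset.mul_sum, ha2, mul_one]
    unfold diagQuad
    rw [this]
    ring
  rw [hshift] at hi1
  rw [abs_le] at hi1 hi2 hmm
  linarith [hi1.2, hi2.1, hmm.1]

end

/-! ### Standardization and reduction to the diagonal case -/

noncomputable section

variable {d n : ℕ}

lemma toEuclideanCLM_mul_apply (A B : Matrix (Fin d) (Fin d) ℝ) (x : EuclideanSpace ℝ (Fin d)) :
    Matrix.toEuclideanCLM (𝕜 := ℝ) (A * B) x
      = Matrix.toEuclideanCLM (𝕜 := ℝ) A (Matrix.toEuclideanCLM (𝕜 := ℝ) B x) := by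
  rw [map_mul]; rfl

lemma exists_isometry_of_transpose_mul_self {O : Matrix (Fin d) (Fin d) ℝ}
    (hO : O.transpose * O = 1) :
    ∃ U : EuclideanSpace ℝ (Fin d) ≃ₗᵢ[ℝ] EuclideanSpace ℝ (Fin d),
      ∀ x, U x = Matrix.toEuclideanCLM (𝕜 := ℝ) O x := by
  have hadj : ContinuousLinearMap.adjoint (Matrix.toEuclideanCLM (𝕜 := ℝ) O)
      = Matrix.toEuclideanCLM (𝕜 := ℝ) O.transpose := by
    rw [← ContinuousLinearMap.star_eq_adjoint, ← map_star, Matrix.star_eq_conjTranspose,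
      Matrix.conjTranspose_eq_transpose_of_trivial]
  have hnorm : ∀ x, ‖Matrix.toEuclideanCLM (𝕜 := ℝ) O x‖ = ‖x‖ := by
    intro x
    have h : ‖Matrix.toEuclideanCLM (𝕜 := ℝ) O x‖ ^ 2 = ‖x‖ ^ 2 := by
      rw [← real_inner_self_eq_norm_sq, ← ContinuousLinearMap.adjoint_inner_left, hadj,
        ← toEuclideanCLM_mul_apply, hO, map_one,
        one_apply_eq_self, real_inner_self_eq_norm_sq]
    exact (sq_eq_sq₀ (norm_nonneg _) (norm_nonneg _)).1 h
  let f : EuclideanSpace ℝ (Fin d) →ₗᵢ[ℝ] EuclideanSpace ℝ (Fin d) :=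
    ⟨(Matrix.toEuclideanCLM (𝕜 := ℝ) O).toLinearMap, hnorm⟩
  exact ⟨f.toLinearIsometryEquiv rfl, fun x => rfl⟩

open scoped MatrixOrder in
lemma posDef_sqrt_facts {S : Matrix (Fin d) (Fin d) ℝ} (hS : S.PosDef) :
    CFC.sqrt S * CFC.sqrt S = S ∧ (CFC.sqrt S).transpose = CFC.sqrt S ∧
      CFC.sqrt S * invSqrt S = 1 ∧ invSqrt S * CFC.sqrt S = 1 ∧
      (invSqrt S).transpose = invSqrt S := by
  have h1 : CFC.sqrt S * CFC.sqrt S = S := CFC.sqrt_mul_sqrt_self S hS.posSemidef.nonneg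
  have h2 : (CFC.sqrt S).transpose = CFC.sqrt S := by
    have := (CFC.sqrt_nonneg S).isSelfAdjoint.star_eq
    rwa [Matrix.star_eq_conjTranspose, Matrix.conjTranspose_eq_transpose_of_trivial] at this
  have h3 : IsUnit (CFC.sqrt S).det := by
    rw [isUnit_iff_ne_zero]
    intro h0
    have := hS.det_pos
    rw [← h1, Matrix.det_mul, h0] at this
    simp at this
  refine ⟨h1, h2, Matrix.mul_nonsing_inv _ h3, Matrix.nonsing_inv_mul _ h3, ?_⟩
  unfold invSqrt
  rw [Matrix.transpose_nonsing_inv, h2]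

/-- The standardization map `x ↦ Σ^{-1/2} (x - μ)`. -/
def standardize (θ : MeanCov d) (x : EuclideanSpace ℝ (Fin d)) : EuclideanSpace ℝ (Fin d) :=
  Matrix.toEuclideanCLM (𝕜 := ℝ) (invSqrt θ.cov) (x - θ.mean)

lemma continuous_standardize (θ : MeanCov d) : Continuous (standardize θ) := by
  unfold standardize; fun_prop

open scoped MatrixOrder in
lemma sqrt_standardize (θ : MeanCov d) (x : EuclideanSpace ℝ (Fin d)) :
    Matrix.toEuclideanCLM (𝕜 := ℝ) (CFC.sqrt θ.cov) (standardize θ x) = x - θ.mean := by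
  unfold standardize
  rw [← toEuclideanCLM_mul_apply, (posDef_sqrt_facts θ.posDef).2.2.1, map_one,
    one_apply_eq_self]

open scoped MatrixOrder in
lemma map_standardize_multivariateGaussian (θ : MeanCov d) :
    (multivariateGaussian θ.mean θ.cov).map (standardize θ) = gaussianStd d := by
  unfold multivariateGaussian
  rw [Measure.map_map (continuous_standardize θ).measurable
    (Continuous.measurable (by fun_prop))]
  have : standardize θ ∘ (fun x => θ.mean + Matrix.toEuclideanCLM (𝕜 := ℝ) (CFC.sqrt θ.cov) x)
      = id := by
    ext1 x
    simp only [Function.comp, standardize, add_sub_cancel_left, id]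
    rw [← toEuclideanCLM_mul_apply, (posDef_sqrt_facts θ.posDef).2.2.2.1, map_one,
      one_apply_eq_self]
  rw [this, Measure.map_id]

/-- Only an inequality is stated, since it holds for arbitrary `B`; measurability of the test event
is never needed. -/
lemma gaussianSamples_standardize_le (θ : MeanCov d) (B : Set (Dataset d n)) :
    gaussianSamples n θ {X | (fun i => standardize θ (X i)) ∈ B} ≤ gaussianStdSamples d n B := by
  have hmap : (gaussianSamples n θ).map (fun X i => standardize θ (X i))
      = gaussianStdSamples d n := by
    unfold gaussianSamples
    rw [Measure.pi_map_pi fun _ => (continuous_standardize θ).aemeasurable]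
    simp_rw [map_standardize_multivariateGaussian]
  rw [← hmap]
  refine Measure.le_map_apply (Measurable.aemeasurable ?_) B
  exact measurable_pi_lambda _ fun i =>
    (continuous_standardize θ).measurable.comp (measurable_pi_apply i)

lemma toEuclideanCLM_diagonal (s : Fin d → ℝ) (x : EuclideanSpace ℝ (Fin d)) :
    Matrix.toEuclideanCLM (𝕜 := ℝ) (Matrix.diagonal s) x = scaleVec s x := by
  ext j
  simp [scaleVec, Matrix.ofLp_toEuclideanCLM, Matrix.mulVec_diagonal]

/-- Operator and Frobenius norms of an orthogonally diagonalized matrix. -/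
lemma opNorm_frobNorm_orthogonal_diagonal {V : Matrix (Fin d) (Fin d) ℝ} {l : Fin d → ℝ}
    (hV : V.transpose * V = 1) {κ : ℝ} (hκ : 0 ≤ κ) (hl : ∀ j, |l j| ≤ κ) :
    opNorm (V * Matrix.diagonal l * V.transpose) ≤ κ ∧
      frobNorm (V * Matrix.diagonal l * V.transpose) = √(∑ j, l j ^ 2) := by
  constructor
  · obtain ⟨U, hU⟩ := exists_isometry_of_transpose_mul_self hV
    obtain ⟨U', hU'⟩ := exists_isometry_of_transpose_mul_self (O := V.transpose)
      (by rw [Matrix.transpose_transpose]; exact mul_eq_one_comm.1 hV)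
    refine ContinuousLinearMap.opNorm_le_bound _ hκ fun x => ?_
    rw [toEuclideanCLM_mul_apply, toEuclideanCLM_mul_apply,
      ← hU', ← hU, U.norm_map, toEuclideanCLM_diagonal]
    refine le_of_sq_le_sq ?_ (by positivity)
    rw [norm_scaleVec_sq, mul_pow, ← U'.norm_map x, EuclideanSpace.real_norm_sq_eq, Finset.mul_sum]
    refine Finset.sum_le_sum fun j _ => mul_le_mul_of_nonneg_right ?_ (sq_nonneg _)
    rw [← sq_abs]
    exact pow_le_pow_left₀ (abs_nonneg _) (hl j) 2
  · unfold frobNorm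
    congr 1
    set M := V * Matrix.diagonal l * V.transpose with hM
    have hMt : M.transpose = M := by
      rw [hM]; simp [Matrix.transpose_mul, Matrix.mul_assoc]
    have h1 : ∑ i, ∑ j, M i j ^ 2 = (M * M.transpose).trace := by
      simp [Matrix.trace, Matrix.mul_apply, sq]
    have h2 : M * M = V * (Matrix.diagonal l * Matrix.diagonal l) * V.transpose := by
      rw [hM]
      calc _ = V * Matrix.diagonal l * (V.transpose * V) * Matrix.diagonal l * V.transpose := by
            simp only [Matrix.mul_assoc]
        _ = _ := by rw [hV]; simp only [Matrix.mul_assoc, Matrix.one_mul]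
    rw [h1, hMt, h2, Matrix.trace_mul_comm, ← Matrix.mul_assoc, hV, Matrix.one_mul,
      Matrix.diagonal_mul_diagonal, Matrix.trace_diagonal]
    exact Finset.sum_congr rfl fun j _ => by ring

/-- Simultaneous diagonalization: `R S` is a diagonal scaling between two orthonormal bases, and
`R S² R` is diagonal in the first of them. -/
lemma exists_diagonalization {R S C : Matrix (Fin d) (Fin d) ℝ} (hR : IsUnit R)
    (hRt : R.transpose = R) (hSt : S.transpose = S) (hSC : S * S = C) (hC : C.PosDef) :
    ∃ (V O : Matrix (Fin d) (Fin d) ℝ) (s : Fin d → ℝ), (∀ j, 0 < s j) ∧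
      V.transpose * V = 1 ∧ O.transpose * O = 1 ∧
      Matrix.diagonal s * O = V.transpose * R * S ∧
      R * C * R - 1 = V * Matrix.diagonal (fun j => s j ^ 2 - 1) * V.transpose := by
  have hT : (R * C * R).PosDef := by
    have := (Matrix.IsUnit.posDef_star_left_conjugate_iff hR (x := C)).2 hC
    rwa [Matrix.star_eq_conjTranspose, Matrix.conjTranspose_eq_transpose_of_trivial, hRt] at this
  obtain ⟨V, t, ht0, hV, hspec⟩ : ∃ (V : Matrix (Fin d) (Fin d) ℝ) (t : Fin d → ℝ),
      (∀ j, 0 < t j) ∧ V.transpose * V = 1 ∧ R * C * R = V * Matrix.diagonal t * V.transpose := by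
    refine ⟨hT.1.eigenvectorUnitary, hT.1.eigenvalues, hT.eigenvalues_pos, ?_, ?_⟩
    · have := Unitary.coe_star_mul_self hT.1.eigenvectorUnitary
      rwa [Matrix.star_eq_conjTranspose, Matrix.conjTranspose_eq_transpose_of_trivial] at this
    · have := hT.1.spectral_theorem
      rw [Unitary.conjStarAlgAut_apply, Matrix.star_eq_conjTranspose,
        Matrix.conjTranspose_eq_transpose_of_trivial] at this
      exact this
  have hV' : V * V.transpose = 1 := mul_eq_one_comm.1 hV
  obtain ⟨s, hs0, hst⟩ : ∃ s : Fin d → ℝ, (∀ j, 0 < s j) ∧ ∀ j, s j ^ 2 = t j :=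
    ⟨fun j => √(t j), fun j => Real.sqrt_pos.2 (ht0 j), fun j => Real.sq_sqrt (ht0 j).le⟩
  -- This is the singular value decomposition of `R * S`, obtained from the spectral theorem for `(R
  -- S)(R S)ᵀ = R C R`.
  refine ⟨V, Matrix.diagonal (fun j => (s j)⁻¹) * V.transpose * R * S, s, hs0, hV,
    mul_eq_one_comm.1 ?_, ?_, ?_⟩
  · have h1 : (Matrix.diagonal (fun j => (s j)⁻¹) * V.transpose * R * S).transpose
        = S * R * V * Matrix.diagonal fun j => (s j)⁻¹ := by
      simp only [Matrix.transpose_mul, Matrix.transpose_transpose, Matrix.diagonal_transpose, hRt,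
        hSt, Matrix.mul_assoc]
    calc _ = Matrix.diagonal (fun j => (s j)⁻¹) * V.transpose *
          (R * (S * S) * R) * V * Matrix.diagonal (fun j => (s j)⁻¹) := by
          rw [h1]; simp only [Matrix.mul_assoc]
      _ = Matrix.diagonal (fun j => (s j)⁻¹) * (V.transpose * V) * Matrix.diagonal t *
          (V.transpose * V) * Matrix.diagonal (fun j => (s j)⁻¹) := by
          rw [hSC, hspec]; simp only [Matrix.mul_assoc]
      _ = 1 := by
          rw [hV, Matrix.mul_one, Matrix.mul_one, Matrix.diagonal_mul_diagonal,
            Matrix.diagonal_mul_diagonal, ← Matrix.diagonal_one]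
          congr 1
          ext j
          have := (hs0 j).ne'
          rw [← hst j]
          field_simp
  · rw [← Matrix.mul_assoc, ← Matrix.mul_assoc, ← Matrix.mul_assoc, Matrix.diagonal_mul_diagonal]
    have : (fun j => s j * (s j)⁻¹) = fun _ => 1 := by
      ext j; exact mul_inv_cancel₀ (hs0 j).ne'
    rw [this, Matrix.diagonal_one, Matrix.one_mul]
  · have : Matrix.diagonal (fun j => s j ^ 2 - 1) = Matrix.diagonal t - 1 := by
      rw [← Matrix.diagonal_one, Matrix.diagonal_sub]
      simp only [hst]
    rw [this, Matrix.mul_sub, Matrix.sub_mul, ← hspec, Matrix.mul_one, hV']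

open scoped MatrixOrder in
/-- Two Gaussian models that fit nearly the same data are close. -/
lemma approx_of_looksGaussian (hn : 0 < n) {γ ρ η : ℝ} (hη : η ≤ γ) (hγ0 : 0 < γ)
    (hγ : γ ≤ 1 / 10 ^ 5) (hγρ : γ ≤ ρ) {θ θ' : MeanCov d} {X Y : Dataset d n}
    (hX : LooksGaussian γ ρ fun i => standardize θ (X i))
    (hY : LooksGaussian γ ρ fun i => standardize θ' (Y i))
    {I : Finset (Fin n)} (hI : (I.card : ℝ) ≤ 2 * η * n) (hXY : ∀ i ∉ I, X i = Y i) :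
    Approx (48 * γ) (2000 * ρ) (48 * γ) θ' θ := by
  obtain ⟨-, -, -, hRS, hRt⟩ := posDef_sqrt_facts θ.posDef
  obtain ⟨hS, hSt, -, -, -⟩ := posDef_sqrt_facts θ'.posDef
  obtain ⟨V, O, s, hs0, hV, hO, hsO, hdiag⟩ :=
    exists_diagonalization (IsUnit.of_mul_eq_one _ hRS) hRt hSt hS θ'.posDef
  obtain ⟨U₁, hU₁⟩ := exists_isometry_of_transpose_mul_self (O := V.transpose)
    (by rw [Matrix.transpose_transpose]; exact mul_eq_one_comm.1 hV)
  obtain ⟨U₂, hU₂⟩ := exists_isometry_of_transpose_mul_self hO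
  -- At a common point, `Σ^{-1/2}(x - μ) = Σ^{-1/2}(μ' - μ) + Σ^{-1/2} Σ'^{1/2} w` with `w` its
  -- standardization by `θ'`; applying `Vᵀ` makes the matrix `diag(s) O`.
  have heq : ∀ i ∉ I, U₁ (standardize θ (X i)) =
      U₁ (Matrix.toEuclideanCLM (𝕜 := ℝ) (invSqrt θ.cov) (θ'.mean - θ.mean)) +
        scaleVec s (U₂ (standardize θ' (Y i))) := by
    intro i hi
    rw [hU₂, ← toEuclideanCLM_diagonal, ← toEuclideanCLM_mul_apply, hsO,
      toEuclideanCLM_mul_apply, toEuclideanCLM_mul_apply, sqrt_standardize,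
      ← hU₁, ← map_add, ← map_add, hXY i hi, standardize]
    congr 2
    abel
  have hc1 := hX.cosTest.comp_isometry U₁
  have hc2 := hY.cosTest.comp_isometry U₂
  have hsc := abs_sq_sub_one_le hn hη hγ hc1 hc2 hs0 hI heq
  have hmn := norm_mean_le hn hη hγ0 hγ hc1 hc2 hsc hI heq
  have hfr : √(∑ j, (s j ^ 2 - 1) ^ 2) ≤ 2000 * ρ := by
    rcases le_or_gt ρ 200 with h | h
    · exact sum_sq_le_of_clipTest hn hη hγ0 hγ hγρ h (hX.clipTest h U₁) (hY.clipTest h U₂) hsc hmn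
        hI heq
    · exact sum_sq_le_of_countTest hn hη hγ0 hγ (by linarith) (hX.countTest h U₁)
        (hY.countTest h U₂) hsc hmn hI heq
  obtain ⟨hop, hfrob⟩ := opNorm_frobNorm_orthogonal_diagonal hV (by positivity) hsc
  refine ⟨?_, ?_, ?_⟩
  · rw [hdiag]; exact hop
  · rw [hdiag, hfrob]; exact hfr
  · rw [U₁.norm_map] at hmn; exact hmn

end

/-! ### The estimator -/

theorem mainTheorem4 :
    ∃ (c₀ C₀ K : ℝ) (p : ℕ), 0 < c₀ ∧ c₀ < 0.01 ∧ 1 < C₀ ∧ 0 < K ∧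
      ∀ (d n : ℕ) (η γ ρ β : ℝ),
        0 ≤ η → η ≤ γ → 0 < γ → γ ≤ c₀ →
        0 < β → β < 1 →
        0 < ρ → K * η * Real.log (1 / η) ^ p ≤ ρ → ρ ≤ c₀ * Real.sqrt d →
        K * sampleTerm d β γ ρ * Real.log (sampleTerm d β γ ρ) ^ p ≤ n →
        ∃ A₀ : Dataset d n → MeanCov d, ∀ θ : MeanCov d,
          gaussianSamples n θ
              {X | ¬ ∀ X' : Dataset d n, IsCorruption η X X' →
                Approx (C₀ * γ) (C₀ * ρ) (C₀ * γ) (A₀ X') θ}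
            ≤ ENNReal.ofReal β := by
  classical
  -- The value `2000` is dictated by the Frobenius bound, the other two needing only `48`. The
  -- factor `10 ^ 14` is dominated by the truncated test, which needs `19·2312·10⁸`.
  refine ⟨1 / 10 ^ 5, 2000, 10 ^ 14, 1, by norm_num, by norm_num, by norm_num, by norm_num, ?_⟩
  intro d n η γ ρ β hη0 hηγ hγ0 hγ hβ0 hβ1 hρ0 hηρ hρd hn
  rw [pow_one] at hηρ hn
  set f := sampleTerm d β γ ρ with hf
  -- The comparison of models needs a spectral tolerance at most `ρ`, so `γ` is replaced by `min γ
  -- ρ`. The sample size still suffices, as `D/ρ² ≤ D²/ρ²`.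
  set g := min γ ρ with hg
  have hg0 : 0 < g := lt_min hγ0 hρ0
  have hgγ : g ≤ γ := min_le_left _ _
  have hgρ : g ≤ ρ := min_le_right _ _
  have hg5 : g ≤ 1 / 10 ^ 5 := hgγ.trans hγ
  have hηg : η ≤ g := by
    refine le_min hηγ ?_
    rcases hη0.eq_or_lt with h | h
    · rw [← h]; exact hρ0.le
    · have h1 : 1 ≤ Real.log (1 / η) := by
        rw [Real.le_log_iff_exp_le (by positivity), le_div_iff₀ h]
        have h2 : Real.exp 1 * η ≤ 3 * (1 / 10 ^ 5) := by
          gcongr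
          · linarith [Real.exp_one_lt_d9]
          · linarith
        linarith
      have h3 : 10 ^ 14 * η * 1 ≤ 10 ^ 14 * η * Real.log (1 / η) := by gcongr
      linarith
  have hd0 : 0 < d := by
    rcases Nat.eq_zero_or_pos d with h | h
    · subst h; simp at hρd; linarith
    · exact h
  have hd : (1 : ℝ) ≤ d := by exact_mod_cast hd0
  have hL : 0 < Real.log (1 / β) := Real.log_pos (by rw [lt_div_iff₀ hβ0]; linarith)
  have hD : 1 ≤ d + Real.log (1 / β) := by linarith
  have hpos1 : 0 ≤ (d + Real.log (1 / β)) / γ ^ 2 := by positivity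
  have hpos2 : 0 ≤ (d + Real.log (1 / β)) ^ 2 / ρ ^ 2 := by positivity
  have hf1 : (d + Real.log (1 / β)) / g ^ 2 ≤ f := by
    rw [hf, sampleTerm]
    rcases min_choice γ ρ with h | h
    · rw [hg, h]; linarith
    · rw [hg, h]
      have : (d + Real.log (1 / β)) / ρ ^ 2 ≤ (d + Real.log (1 / β)) ^ 2 / ρ ^ 2 := by
        gcongr
        exact le_self_pow₀ hD two_ne_zero
      linarith
  have hf2 : (d + Real.log (1 / β)) ^ 2 / ρ ^ 2 ≤ f := by
    rw [hf, sampleTerm]; linarith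
  have hprob := measureReal_not_looksGaussian_le (n := n) hg0 hg5 hβ0 hβ1 hρ0
    (hρd.trans (by linarith [Real.sqrt_nonneg (d : ℝ)])) hf1 hf2 hn
  have hn0 : 0 < n := by
    have h1 : 1 < f := by
      refine lt_of_lt_of_le ?_ hf1
      rw [lt_div_iff₀ (by positivity)]
      have : g ^ 2 < 1 := pow_lt_one₀ hg0.le (by linarith) two_ne_zero
      linarith
    have h2 : (0 : ℝ) < n := lt_of_lt_of_le (by have := Real.log_pos h1; positivity) hn
    exact_mod_cast h2
  let fits : Dataset d n → MeanCov d → Prop := fun X' θ =>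
    ∃ Y : Dataset d n, IsCorruption η Y X' ∧ LooksGaussian g ρ fun i => standardize θ (Y i)
  let A₀ : Dataset d n → MeanCov d := fun X' =>
    -- The fallback model is irrelevant: on the good event the true `θ` fits every admissible `X'`.
    if h : ∃ θ, fits X' θ then h.choose else ⟨0, 1, Matrix.PosDef.one⟩
  refine ⟨A₀, fun θ => ?_⟩
  calc gaussianSamples n θ _
      ≤ gaussianSamples n θ {X | (fun i => standardize θ (X i)) ∈
          {Z : Dataset d n | ¬ LooksGaussian g ρ Z}} := by
        refine measure_mono fun X hX hgood => hX fun X' hX' => ?_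
        have hex : ∃ θ, fits X' θ := ⟨θ, X, hX', hgood⟩
        have hA : A₀ X' = hex.choose := dif_pos hex
        rw [hA]
        obtain ⟨Y, hY, hYg⟩ := hex.choose_spec
        -- Both `X` and `Y` are within `ηn` of `X'`, so the triangle inequality for the Hamming
        -- distance gives `2ηn`.
        have hcard : ((Finset.univ.filter fun i => X i ≠ Y i).card : ℝ) ≤ 2 * η * n := by
          unfold IsCorruption at hX' hY
          have h1 := hammingDist_triangle_right X Y X'
          have h2 : ((hammingDist X Y : ℕ) : ℝ) ≤ hammingDist X X' + hammingDist Y X' := by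
            exact_mod_cast h1
          have h3 : ((Finset.univ.filter fun i => X i ≠ Y i).card : ℝ) = (hammingDist X Y : ℕ) := rfl
          rw [h3]
          have h4 : ((hammingDist X X' : ℕ) : ℝ) ≤ η * n := by convert hX'
          have h5 : ((hammingDist Y X' : ℕ) : ℝ) ≤ η * n := by convert hY
          linarith
        have happ := approx_of_looksGaussian hn0 hηg hg0 hg5 hgρ hgood hYg hcard
          (fun i hi => by simpa using hi)
        exact ⟨happ.spectral.trans (by linarith), happ.frobenius,
          happ.mahalanobis.trans (by linarith)⟩
    _ ≤ gaussianStdSamples d n {Z | ¬ LooksGaussian g ρ Z} := gaussianSamples_standardize_le θ _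
    _ ≤ ENNReal.ofReal β := by
        rw [← ofReal_measureReal]
        exact ENNReal.ofReal_le_ofReal hprob
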